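/- **Definitions.** An *arrow presentation* $G$ consists of finitely many circles (its *vertices*; $V(G)$ is the set of vertices), finitely many pairwise disjoint directed arcs (*arrows*) on them, and a labelling of the arrows by a set $E(G)$ of *edges* in which each edge labels exactly two arrows. An arrow from $p$ to $q$ is written $\overrightarrow{pq}$. The *boundary components* of $G$ are the closed curves obtained by removing the interiors of all arrows and then, for each edge with arrows $\overrightarrow{p_1p_2},\overrightarrow{q_1q_2}$, joining $p_2$ to $q_1$ and $q_2$ to $p_1$ by new curves. A *packaged arrow presentation* is a triple $(G,\mathcal V,\mathcal B)$ with $\mathcal V$ a partition of the set of vertices and $\mathcal B$ a partition of the set of boundary components of $G$; vertices, edges, etc. of the triple are those of $G$. We identify $\mathcal V$ and $\mathcal B$ with the partitions they induce on the set of end points of arrows together with the circles without arrows, so that they make sense after the curves are reconnected. Let $e$ be an edge with arrows $\overrightarrow{p_1p_2},\overrightarrow{q_1q_2}$. In the arrow presentation, *deleting* $e$ removes the two arrows but keeps the arcs they lie on; *contracting* $e$ removes the arrows with these arcs and identifies $p_1$ with $q_2$ and $p_2$ with $q_1$; *Penrose-contracting* $e$ removes the arrows with these arcs and identifies $p_1$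 with $q_1$ and $p_2$ with $q_2$. In each case $e$ is removed from the edge set. Let $\mathcal V_e$ be $\mathcal V$ with the classes of the vertices carrying the two arrows of $e$ united, and $\mathcal B_e$ be $\mathcal B$ with the class of the boundary component through $p_1,q_2$ and the class of the one through $p_2,q_1$ united. (Vertices or boundary components created by an operation belong to the united class.) The five operations on a packaged arrow presentation $G$ are - $G\setminus e$ (delete): delete $e$, with partitions $\mathcal V,\mathcal B_e$; - $G/e$ (contract): contract $e$, with partitions $\mathcal V_e,\mathcal B$; - $G^{\times}e$ (Penrose-contract): Penrose-contract $e$, with partitions $\mathcal V_e,\mathcal B_e$; - $G\mathbin{\overline{\setminus}}e$ (merge-delete): delete $e$, with partitions $\mathcal V_e,\mathcal B_e$; - $G\mathbin{\overline{/}}e$ (merge-contract): contract $e$, with partitions $\mathcal V_e,\mathcal B_e$. A *coupling* $\varphi$ of an edge $f$ of $G$ and an edge $e$ of $H$ is a bijection from the two arrows of $f$ to the two arrows of $e$. If it sends $\overrightarrow{p_1p_2}\mapsto\overrightarrow{q_1q_2}$ and $\overrightarrow{p_3p_4}\mapsto\overrightarrow{q_3q_4}$, the *2-sum* $G\oplus_\varphi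 H$ is obtained from the disjoint union of $G$ and $H$ by removing the four arrows with the arcs they lie on and identifying $p_i$ with $q_i$ for $i=1,\dots,4$. Its vertex partition is the union of the two vertex partitions with the class of the vertex through $p_1,p_2$ united with that of the vertex through $q_1,q_2$, and the class of the vertex through $p_3,p_4$ united with that of the vertex through $q_3,q_4$. Its boundary partition is the union of the two boundary partitions with the class of the boundary component through $p_1,p_4$ united with that of the one through $q_1,q_4$, and the class of the one through $p_2,p_3$ united with that of the one through $q_2,q_3$. Given an edge $e$ of $H$ and a coupling $\varphi_f$ of $f$ and $e$ for every $f\in E(G)$, the *tensor product* $G\otimes_{\boldsymbol\varphi}H$, $\boldsymbol\varphi=\{\varphi_f\}_{f\in E(G)}$, is obtained from $G$ by taking, for each $f\in E(G)$ in turn (in any order), the 2-sum along $f$ and $e$ with a new copy of $H$, with respect to $\varphi_f$. **Theorem.** There is a unique map $Q$ from packaged arrow presentations to $\mathbb Z[a,b,c,x,y,\alpha,\beta,\gamma]$ such that $$Q(G)=a\,Q(G\setminus e)+b\,Q(G/e)+c\,Q(G^{\times}e)+x\,Q(G\mathbin{\overline{\setminus}}e)+y\,Q(G\mathbin{\overline{/}}e)$$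 for every $G$ and every edge $e$ of $G$, and $Q(G)=\alpha^{|V(G)|}\beta^{|\mathcal V|}\gamma^{|\mathcal B|}$ if $G$ has no edges. Moreover, let $G$ and $H$ be packaged arrow presentations, $e$ an edge of $H$, and, for each edge $f$ of $G$, $\varphi_f$ a coupling of $f$ and $e$. Then the linear system $$\alpha\beta\gamma\begin{bmatrix}\alpha\beta&1&1&\alpha&1\\1&\alpha\gamma&1&1&\alpha\\1&1&\alpha&1&1\\\alpha&1&1&\alpha&1\\1&\alpha&1&1&\alpha\end{bmatrix}\begin{bmatrix}\phi_{(=,2)}\\\phi_{(\parallel,2)}\\\phi_\times\\\phi_{(=,1)}\\\phi_{(\parallel,1)}\end{bmatrix}=\begin{bmatrix}Q(H\setminus e)\\Q(H/e)\\Q(H^{\times}e)\\Q(H\mathbin{\overline{\setminus}}e)\\Q(H\mathbin{\overline{/}}e)\end{bmatrix}$$ has a unique solution over the field of fractions of $\mathbb Z[a,b,c,x,y,\alpha,\beta,\gamma]$, and for this solution $$Q(G\otimes_{\boldsymbol\varphi}H;a,b,c,x,y,\alpha,\beta,\gamma)=Q\big(G;\phi_{(=,2)},\phi_{(\parallel,2)},\phi_\times,\phi_{(=,1)},\phi_{(\parallel,1)},\alpha,\beta,\gamma\big).$$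 -/

import Mathlib

open MvPolynomial

universe u

/-- An arrow presentation: finitely many circles carrying pairwise disjoint directed arcs (arrows),
every edge labelling exactly two arrows.

The circles are cut at the end points of the arrows and at finitely many auxiliary points away from
the arrows, at least one on each circle that has no arrow.  Leaving out the arrows, the circles fall
into finitely many arcs, and `Pt` is the set of all ends of these arcs.

* `arc` sends an end of an arc to the other end of the same arc.
* `arrow (e, i, false)` and `arrow (e, i, true)` are the tail and the head of the `i`-th (`i : Bool`)
  of the two arrows labelled `e`; each of them is the end of exactly one arc.
* `join` fixes exactly the end points of the arrows; every other end of an arc lies at an auxiliary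
  point, and `join` sends it to the end of an arc on the other side of that point.

The auxiliary points have no meaning of their own: they only say how arcs are concatenated. -/
structure ArrowPresentation : Type (u + 1) where
  Pt : Type u
  E : Type u
  finite_pt : Finite Pt
  arc : Pt → Pt
  arc_arc : ∀ x, arc (arc x) = x
  arc_ne : ∀ x, arc x ≠ x
  arrow : E × Bool × Bool → Pt
  arrow_injective : Function.Injective arrow
  join : Pt → Pt
  join_join : ∀ x, join (join x) = x
  join_eq_self_iff : ∀ x, join x = x ↔ x ∈ Set.range arrow

namespace ArrowPresentation

/-- The tail of the `i`-th arrow labelled `e`. -/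
def tail (G : ArrowPresentation.{u}) (e : G.E) (i : Bool) : G.Pt := G.arrow (e, i, false)

/-- The head of the `i`-th arrow labelled `e`. -/
def head (G : ArrowPresentation.{u}) (e : G.E) (i : Bool) : G.Pt := G.arrow (e, i, true)

/-- Two points lie on the same circle (vertex): move along arcs, through marked points, and along
arrows from tail to head. -/
def vertexSetoid (G : ArrowPresentation.{u}) : Setoid G.Pt :=
  Relation.EqvGen.setoid fun x y =>
    y = G.arc x ∨ y = G.join x ∨ ∃ e i, x = G.tail e i ∧ y = G.head e i

/-- Two points lie on the same boundary component: the arrows are removed, and for each edge the head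
of each of its two arrows is joined to the tail of the other one. -/
def boundarySetoid (G : ArrowPresentation.{u}) : Setoid G.Pt :=
  Relation.EqvGen.setoid fun x y =>
    y = G.arc x ∨ y = G.join x ∨ ∃ e i, x = G.head e i ∧ y = G.tail e (!i)

/-- The set of vertices (circles). -/
def Vertex (G : ArrowPresentation.{u}) : Type u := Quotient G.vertexSetoid

/-- The set of boundary components. -/
def Boundary (G : ArrowPresentation.{u}) : Type u := Quotient G.boundarySetoid

theorem finite_edges (G : ArrowPresentation.{u}) : Finite G.E :=
  have := G.finite_pt
  Finite.of_injective (fun e => G.arrow (e, false, false)) fun _ _ h =>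
    congrArg Prod.fst (G.arrow_injective h)

theorem arrow_at_injective (G : ArrowPresentation.{u}) (e : G.E) :
    Function.Injective fun j : Bool × Bool => G.arrow (e, j) := fun _ _ h =>
  congrArg Prod.snd (G.arrow_injective h)

/-- Remove the edge `e`, with its two arrows, and identify the four end points of these arrows in
pairs as prescribed by the fixed point free involution `ρ` of (arrow, end). -/
noncomputable def resolve (G : ArrowPresentation.{u}) (e : G.E) (ρ : Bool × Bool → Bool × Bool)
    (hρ : ∀ j, ρ (ρ j) = j) (hρ' : ∀ j, ρ j ≠ j) : ArrowPresentation.{u} where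
  Pt := G.Pt
  E := {f : G.E // f ≠ e}
  finite_pt := G.finite_pt
  arc := G.arc
  arc_arc := G.arc_arc
  arc_ne := G.arc_ne
  arrow := fun p => G.arrow (p.1.1, p.2)
  arrow_injective := by
    rintro ⟨⟨f, hf⟩, j⟩ ⟨⟨f', hf'⟩, j'⟩ h
    have := G.arrow_injective h
    simp_all
  join := Function.extend (fun j => G.arrow (e, j)) (fun j => G.arrow (e, ρ j)) G.join
  join_join := by
    intro x
    by_cases hx : ∃ j, G.arrow (e, j) = x
    · obtain ⟨j, rfl⟩ := hx
      rw [(G.arrow_at_injective e).extend_apply, (G.arrow_at_injective e).extend_apply, hρ]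
    · rw [Function.extend_apply' _ _ _ hx, Function.extend_apply', G.join_join]
      rintro ⟨j, hj⟩
      have h1 : G.join (G.arrow (e, j)) = G.arrow (e, j) := (G.join_eq_self_iff _).2 ⟨_, rfl⟩
      have h2 : G.join (G.join x) = G.join x := by rw [← hj, h1]
      rw [G.join_join] at h2
      exact hx ⟨j, by rw [h2, ← hj]⟩
  join_eq_self_iff := by
    intro x
    by_cases hx : ∃ j, G.arrow (e, j) = x
    · obtain ⟨j, rfl⟩ := hx
      rw [(G.arrow_at_injective e).extend_apply]
      constructor
      · intro h
        exact absurd (G.arrow_at_injective e h) (hρ' j)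
      · rintro ⟨⟨⟨f, hf⟩, j'⟩, h⟩
        exact absurd (congrArg Prod.fst (G.arrow_injective h)) hf
    · rw [Function.extend_apply' _ _ _ hx, G.join_eq_self_iff]
      constructor
      · rintro ⟨⟨f, j⟩, rfl⟩
        refine ⟨(⟨f, ?_⟩, j), rfl⟩
        rintro rfl
        exact hx ⟨j, rfl⟩
      · rintro ⟨⟨⟨f, hf⟩, j⟩, rfl⟩
        exact ⟨(f, j), rfl⟩

theorem resolve_join_arrow (G : ArrowPresentation.{u}) (e : G.E)
    (ρ : Bool × Bool → Bool × Bool) (hρ : ∀ j, ρ (ρ j) = j) (hρ' : ∀ j, ρ j ≠ j)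
    (j : Bool × Bool) :
    (G.resolve e ρ hρ hρ').join (G.arrow (e, j)) = G.arrow (e, ρ j) :=
  (G.arrow_at_injective e).extend_apply (fun j => G.arrow (e, ρ j)) G.join j

theorem resolve_join_of_not (G : ArrowPresentation.{u}) (e : G.E)
    (ρ : Bool × Bool → Bool × Bool) (hρ : ∀ j, ρ (ρ j) = j) (hρ' : ∀ j, ρ j ≠ j)
    (x : G.Pt) (hx : ¬∃ j, G.arrow (e, j) = x) :
    (G.resolve e ρ hρ hρ').join x = G.join x :=
  Function.extend_apply' (f := fun j => G.arrow (e, j)) (fun j => G.arrow (e, ρ j)) G.join x hx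

/-- `G ∖ e`: the tail and the head of each of the two arrows are joined, that is, the arrows are
forgotten but not the arcs they lie on. -/
noncomputable def delete (G : ArrowPresentation.{u}) (e : G.E) : ArrowPresentation.{u} :=
  G.resolve e (fun j => (j.1, !j.2)) (by decide) (by decide)

/-- `G / e`: the tail of each of the two arrows is identified with the head of the other one. -/
noncomputable def contract (G : ArrowPresentation.{u}) (e : G.E) : ArrowPresentation.{u} :=
  G.resolve e (fun j => (!j.1, !j.2)) (by decide) (by decide)

/-- The Penrose-contraction: the two tails are identified, and so are the two heads. -/
noncomputable def penrose (G : ArrowPresentation.{u}) (e : G.E) : ArrowPresentation.{u} :=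
  G.resolve e (fun j => (!j.1, j.2)) (by decide) (by decide)

theorem coupled_injective (H : ArrowPresentation.{u}) (e : H.E) (φ : Bool ≃ Bool) :
    Function.Injective fun j : Bool × Bool => H.arrow (e, φ j.1, j.2) := by
  rintro ⟨i, s⟩ ⟨i', s'⟩ h
  have := H.arrow_injective h
  simp_all

/-- The 2-sum of `G` and `H` along the edges `f` and `e`.  The coupling is `φ : Bool ≃ Bool`: it sends
the `i`-th arrow of `f` to the `φ i`-th arrow of `e`.  The four arrows are removed, tails of coupled
arrows are identified, and so are their heads. -/
noncomputable def twoSum (G : ArrowPresentation.{u}) (f : G.E) (H : ArrowPresentation.{u}) (e : H.E)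
    (φ : Bool ≃ Bool) : ArrowPresentation.{u} where
  Pt := G.Pt ⊕ H.Pt
  E := {f' : G.E // f' ≠ f} ⊕ {e' : H.E // e' ≠ e}
  finite_pt := by
    have := G.finite_pt
    have := H.finite_pt
    infer_instance
  arc := Sum.map G.arc H.arc
  arc_arc := by rintro (x | x) <;> simp [G.arc_arc, H.arc_arc]
  arc_ne := by rintro (x | x) <;> simp [G.arc_ne, H.arc_ne]
  arrow := fun p => Sum.elim (fun f' => Sum.inl (G.arrow (f'.1, p.2)))
    (fun e' => Sum.inr (H.arrow (e'.1, p.2))) p.1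
  arrow_injective := by
    rintro ⟨⟨f, hf⟩ | ⟨f, hf⟩, j⟩ ⟨⟨f', hf'⟩ | ⟨f', hf'⟩, j'⟩ h
    · have := G.arrow_injective (Sum.inl_injective h)
      simp_all
    · simp at h
    · simp at h
    · have := H.arrow_injective (Sum.inr_injective h)
      simp_all
  join := Sum.elim
    (Function.extend (fun j => G.arrow (f, j)) (fun j => Sum.inr (H.arrow (e, φ j.1, j.2)))
      fun x => Sum.inl (G.join x))
    (Function.extend (fun j => H.arrow (e, φ j.1, j.2)) (fun j => Sum.inl (G.arrow (f, j)))
      fun x => Sum.inr (H.join x))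
  join_join := by
    rintro (x | x)
    · by_cases hx : ∃ j, G.arrow (f, j) = x
      · obtain ⟨j, rfl⟩ := hx
        rw [Sum.elim_inl, (G.arrow_at_injective f).extend_apply, Sum.elim_inr,
          (H.coupled_injective e φ).extend_apply]
      · rw [Sum.elim_inl, Function.extend_apply' _ _ _ hx, Sum.elim_inl, Function.extend_apply',
          G.join_join]
        rintro ⟨j, hj⟩
        have h1 : G.join (G.arrow (f, j)) = G.arrow (f, j) := (G.join_eq_self_iff _).2 ⟨_, rfl⟩
        have h2 : G.join (G.join x) = G.join x := by rw [← hj, h1]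
        rw [G.join_join] at h2
        exact hx ⟨j, by rw [h2, ← hj]⟩
    · by_cases hx : ∃ j : Bool × Bool, H.arrow (e, φ j.1, j.2) = x
      · obtain ⟨j, rfl⟩ := hx
        rw [Sum.elim_inr, (H.coupled_injective e φ).extend_apply, Sum.elim_inl,
          (G.arrow_at_injective f).extend_apply]
      · rw [Sum.elim_inr, Function.extend_apply' _ _ _ hx, Sum.elim_inr, Function.extend_apply',
          H.join_join]
        rintro ⟨j, hj⟩
        have h1 : H.join (H.arrow (e, φ j.1, j.2)) = H.arrow (e, φ j.1, j.2) :=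
          (H.join_eq_self_iff _).2 ⟨_, rfl⟩
        have h2 : H.join (H.join x) = H.join x := by rw [← hj, h1]
        rw [H.join_join] at h2
        exact hx ⟨j, by rw [h2, ← hj]⟩
  join_eq_self_iff := by
    rintro (x | x)
    · by_cases hx : ∃ j, G.arrow (f, j) = x
      · obtain ⟨j, rfl⟩ := hx
        rw [Sum.elim_inl, (G.arrow_at_injective f).extend_apply]
        refine ⟨fun h => by simp at h, ?_⟩
        rintro ⟨⟨⟨f', hf⟩ | ⟨f', hf⟩, j'⟩, h⟩
        · exact absurd (congrArg Prod.fst (G.arrow_injective (Sum.inl_injective h))) hf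
        · simp at h
      · rw [Sum.elim_inl, Function.extend_apply' _ _ _ hx, Sum.inl_injective.eq_iff,
          G.join_eq_self_iff]
        constructor
        · rintro ⟨⟨f', j⟩, rfl⟩
          refine ⟨(Sum.inl ⟨f', ?_⟩, j), rfl⟩
          rintro rfl
          exact hx ⟨j, rfl⟩
        · rintro ⟨⟨⟨f', hf⟩ | ⟨f', hf⟩, j⟩, h⟩
          · exact ⟨(f', j), Sum.inl_injective h⟩
          · simp at h
    · by_cases hx : ∃ j : Bool × Bool, H.arrow (e, φ j.1, j.2) = x
      · obtain ⟨j, rfl⟩ := hx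
        rw [Sum.elim_inr, (H.coupled_injective e φ).extend_apply]
        refine ⟨fun h => by simp at h, ?_⟩
        rintro ⟨⟨⟨f', hf⟩ | ⟨f', hf⟩, j'⟩, h⟩
        · simp at h
        · exact absurd (congrArg Prod.fst (H.arrow_injective (Sum.inr_injective h))) hf
      · rw [Sum.elim_inr, Function.extend_apply' _ _ _ hx, Sum.inr_injective.eq_iff,
          H.join_eq_self_iff]
        constructor
        · rintro ⟨⟨f', i, s⟩, rfl⟩
          refine ⟨(Sum.inr ⟨f', ?_⟩, i, s), rfl⟩
          rintro rfl
          exact hx ⟨(φ.symm i, s), by simp⟩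
        · rintro ⟨⟨⟨f', hf⟩ | ⟨f', hf⟩, j⟩, h⟩
          · simp at h
          · exact ⟨(f', j), Sum.inr_injective h⟩

theorem twoSum_join_inl_arrow (G : ArrowPresentation.{u}) (f : G.E) (H : ArrowPresentation.{u})
    (e : H.E) (φ : Bool ≃ Bool) (j : Bool × Bool) :
    (G.twoSum f H e φ).join (Sum.inl (G.arrow (f, j))) = Sum.inr (H.arrow (e, φ j.1, j.2)) :=
  (G.arrow_at_injective f).extend_apply
    (fun j => (Sum.inr (H.arrow (e, φ j.1, j.2)) : G.Pt ⊕ H.Pt)) (fun x => Sum.inl (G.join x)) j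

theorem twoSum_join_inl_of_not (G : ArrowPresentation.{u}) (f : G.E) (H : ArrowPresentation.{u})
    (e : H.E) (φ : Bool ≃ Bool) (x : G.Pt) (hx : ¬∃ j, G.arrow (f, j) = x) :
    (G.twoSum f H e φ).join (Sum.inl x) = Sum.inl (G.join x) :=
  Function.extend_apply' (f := fun j => G.arrow (f, j))
    (fun j => (Sum.inr (H.arrow (e, φ j.1, j.2)) : G.Pt ⊕ H.Pt)) (fun x => Sum.inl (G.join x)) x hx

theorem twoSum_join_inr_arrow (G : ArrowPresentation.{u}) (f : G.E) (H : ArrowPresentation.{u})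
    (e : H.E) (φ : Bool ≃ Bool) (j : Bool × Bool) :
    (G.twoSum f H e φ).join (Sum.inr (H.arrow (e, φ j.1, j.2))) = Sum.inl (G.arrow (f, j)) :=
  (H.coupled_injective e φ).extend_apply
    (fun j => (Sum.inl (G.arrow (f, j)) : G.Pt ⊕ H.Pt)) (fun x => Sum.inr (H.join x)) j

theorem twoSum_join_inr_of_not (G : ArrowPresentation.{u}) (f : G.E) (H : ArrowPresentation.{u})
    (e : H.E) (φ : Bool ≃ Bool) (x : H.Pt)
    (hx : ¬∃ j : Bool × Bool, H.arrow (e, φ j.1, j.2) = x) :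
    (G.twoSum f H e φ).join (Sum.inr x) = Sum.inr (H.join x) :=
  Function.extend_apply' (f := fun j : Bool × Bool => H.arrow (e, φ j.1, j.2))
    (fun j => (Sum.inl (G.arrow (f, j)) : G.Pt ⊕ H.Pt)) (fun x => Sum.inr (H.join x)) x hx

end ArrowPresentation

/-- The partition obtained from `r` by uniting the block of `x` with the block of `y`. -/
def mergeBlocks {X : Type u} (r : Setoid X) (x y : X) : Setoid X :=
  r ⊔ Relation.EqvGen.setoid fun x' y' => x' = x ∧ y' = y

/-- The union of a partition of `X` and a partition of `Y`, a partition of the disjoint union. -/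
def sumPartition {X Y : Type u} (r : Setoid X) (s : Setoid Y) : Setoid (X ⊕ Y) where
  r := Sum.LiftRel r s
  iseqv :=
    { refl := by rintro (x | x) <;> constructor <;> exact Setoid.refl _
      symm := by rintro _ _ (⟨h⟩ | ⟨h⟩) <;> constructor <;> exact Setoid.symm h
      trans := by
        rintro _ _ _ (⟨h⟩ | ⟨h⟩) (⟨h'⟩ | ⟨h'⟩) <;> constructor <;> exact Setoid.trans h h' }

theorem le_mergeBlocks {X : Type u} (r : Setoid X) (x y : X) : r ≤ mergeBlocks r x y := le_sup_left

theorem mergeBlocks_rel {X : Type u} (r : Setoid X) (x y : X) : mergeBlocks r x y x y :=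
  (le_sup_right : _ ≤ mergeBlocks r x y) (Relation.EqvGen.rel _ _ ⟨rfl, rfl⟩)

/-- A packaged arrow presentation: an arrow presentation with a partition of its set of vertices and
a partition of its set of boundary components.  A partition of the vertices is the same thing as
a partition `vcl` of the points all of whose blocks are unions of vertices; likewise for `bcl`. -/
structure PackagedArrowPresentation : Type (u + 1) extends ArrowPresentation.{u} where
  vcl : Setoid Pt
  vertexSetoid_le : toArrowPresentation.vertexSetoid ≤ vcl
  bcl : Setoid Pt
  boundarySetoid_le : toArrowPresentation.boundarySetoid ≤ bcl

namespace PackagedArrowPresentation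

/-- The number of vertices, `|V(G)|`. -/
noncomputable def numVertices (G : PackagedArrowPresentation.{u}) : ℕ := Nat.card G.Vertex

/-- The number of vertex classes, `|𝒱|`. -/
noncomputable def numVertexClasses (G : PackagedArrowPresentation.{u}) : ℕ :=
  Nat.card (Quotient G.vcl)

/-- The number of boundary classes, `|ℬ|`. -/
noncomputable def numBoundaryClasses (G : PackagedArrowPresentation.{u}) : ℕ :=
  Nat.card (Quotient G.bcl)

/-- The vertex partition in which the classes of the two vertices incident to `e` (the circles that
carry its two arrows) are united. -/
def mergedVcl (G : PackagedArrowPresentation.{u}) (e : G.E) : Setoid G.Pt :=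
  mergeBlocks G.vcl (G.tail e false) (G.tail e true)

/-- The boundary partition in which the classes of the two boundary components incident to `e` are
united: one of these contains the tail of the first arrow (and the head of the second), the other one
the head of the first arrow (and the tail of the second). -/
def mergedBcl (G : PackagedArrowPresentation.{u}) (e : G.E) : Setoid G.Pt :=
  mergeBlocks G.bcl (G.tail e false) (G.head e false)

theorem vcl_arc (G : PackagedArrowPresentation.{u}) (x : G.Pt) : G.vcl x (G.arc x) :=
  G.vertexSetoid_le (Relation.EqvGen.rel _ _ (Or.inl rfl))

theorem vcl_join (G : PackagedArrowPresentation.{u}) (x : G.Pt) : G.vcl x (G.join x) :=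
  G.vertexSetoid_le (Relation.EqvGen.rel _ _ (Or.inr (Or.inl rfl)))

theorem vcl_arrow (G : PackagedArrowPresentation.{u}) (e : G.E) (i : Bool) :
    G.vcl (G.tail e i) (G.head e i) :=
  G.vertexSetoid_le (Relation.EqvGen.rel _ _ (Or.inr (Or.inr ⟨e, i, rfl, rfl⟩)))

theorem bcl_arc (G : PackagedArrowPresentation.{u}) (x : G.Pt) : G.bcl x (G.arc x) :=
  G.boundarySetoid_le (Relation.EqvGen.rel _ _ (Or.inl rfl))

theorem bcl_join (G : PackagedArrowPresentation.{u}) (x : G.Pt) : G.bcl x (G.join x) :=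
  G.boundarySetoid_le (Relation.EqvGen.rel _ _ (Or.inr (Or.inl rfl)))

theorem bcl_edge (G : PackagedArrowPresentation.{u}) (e : G.E) (i : Bool) :
    G.bcl (G.head e i) (G.tail e (!i)) :=
  G.boundarySetoid_le (Relation.EqvGen.rel _ _ (Or.inr (Or.inr ⟨e, i, rfl, rfl⟩)))

theorem mergedVcl_arrow (G : PackagedArrowPresentation.{u}) (e : G.E) (j j' : Bool × Bool) :
    G.mergedVcl e (G.arrow (e, j)) (G.arrow (e, j')) := by
  have h0 : G.mergedVcl e (G.tail e false) (G.head e false) :=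
    le_mergeBlocks _ _ _ (G.vcl_arrow e false)
  have h1 : G.mergedVcl e (G.tail e true) (G.head e true) :=
    le_mergeBlocks _ _ _ (G.vcl_arrow e true)
  have h2 : G.mergedVcl e (G.tail e false) (G.tail e true) := mergeBlocks_rel _ _ _
  have key : ∀ j : Bool × Bool, G.mergedVcl e (G.tail e false) (G.arrow (e, j)) := by
    rintro ⟨_ | _, _ | _⟩
    · exact Setoid.refl' _ _
    · exact h0
    · exact h2
    · exact Setoid.trans' _ h2 h1
  exact Setoid.trans' _ (Setoid.symm' _ (key j)) (key j')

theorem mergedBcl_arrow (G : PackagedArrowPresentation.{u}) (e : G.E) (j j' : Bool × Bool) :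
    G.mergedBcl e (G.arrow (e, j)) (G.arrow (e, j')) := by
  have h0 : G.mergedBcl e (G.head e false) (G.tail e true) :=
    le_mergeBlocks _ _ _ (G.bcl_edge e false)
  have h1 : G.mergedBcl e (G.head e true) (G.tail e false) :=
    le_mergeBlocks _ _ _ (G.bcl_edge e true)
  have h2 : G.mergedBcl e (G.tail e false) (G.head e false) := mergeBlocks_rel _ _ _
  have key : ∀ j : Bool × Bool, G.mergedBcl e (G.tail e false) (G.arrow (e, j)) := by
    rintro ⟨_ | _, _ | _⟩
    · exact Setoid.refl' _ _
    · exact h2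
    · exact Setoid.trans' _ h2 h0
    · exact Setoid.symm' _ h1
  exact Setoid.trans' _ (Setoid.symm' _ (key j)) (key j')

/-- A partition that is compatible with the circles of `G`, and in which the end points of the edge
`e` are related as they are joined by `ρ`, is compatible with the circles of the resolution. -/
theorem vertexSetoid_resolve_le (G : PackagedArrowPresentation.{u}) (e : G.E)
    (ρ : Bool × Bool → Bool × Bool) (hρ : ∀ j, ρ (ρ j) = j) (hρ' : ∀ j, ρ j ≠ j)
    (r : Setoid G.Pt) (h : G.vcl ≤ r) (he : ∀ j, r (G.arrow (e, j)) (G.arrow (e, ρ j))) :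
    (G.toArrowPresentation.resolve e ρ hρ hρ').vertexSetoid ≤ r := by
  refine Setoid.eqvGen_le ?_
  rintro x y (rfl | rfl | ⟨f, i, rfl, rfl⟩)
  · exact h (G.vcl_arc x)
  · by_cases hx : ∃ j, G.arrow (e, j) = x
    · obtain ⟨j, rfl⟩ := hx
      rw [G.resolve_join_arrow e ρ hρ hρ' j]
      exact he j
    · rw [G.resolve_join_of_not e ρ hρ hρ' x hx]
      exact h (G.vcl_join x)
  · exact h (G.vcl_arrow f.1 i)

theorem boundarySetoid_resolve_le (G : PackagedArrowPresentation.{u}) (e : G.E)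
    (ρ : Bool × Bool → Bool × Bool) (hρ : ∀ j, ρ (ρ j) = j) (hρ' : ∀ j, ρ j ≠ j)
    (r : Setoid G.Pt) (h : G.bcl ≤ r) (he : ∀ j, r (G.arrow (e, j)) (G.arrow (e, ρ j))) :
    (G.toArrowPresentation.resolve e ρ hρ hρ').boundarySetoid ≤ r := by
  refine Setoid.eqvGen_le ?_
  rintro x y (rfl | rfl | ⟨f, i, rfl, rfl⟩)
  · exact h (G.bcl_arc x)
  · by_cases hx : ∃ j, G.arrow (e, j) = x
    · obtain ⟨j, rfl⟩ := hx
      rw [G.resolve_join_arrow e ρ hρ hρ' j]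
      exact he j
    · rw [G.resolve_join_of_not e ρ hρ hρ' x hx]
      exact h (G.bcl_join x)
  · exact h (G.bcl_edge f.1 i)

/-- Delete `e`: the vertex partition is kept, and the two boundary classes at `e` are united (the
boundary components created by the deletion lie in the united class). -/
noncomputable def del (G : PackagedArrowPresentation.{u}) (e : G.E) :
    PackagedArrowPresentation.{u} where
  toArrowPresentation := G.toArrowPresentation.delete e
  vcl := G.vcl
  vertexSetoid_le := by
    refine G.vertexSetoid_resolve_le e _ _ _ _ le_rfl ?_
    rintro ⟨i, _ | _⟩
    · exact G.vcl_arrow e i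
    · exact Setoid.symm' _ (G.vcl_arrow e i)
  bcl := G.mergedBcl e
  boundarySetoid_le := G.boundarySetoid_resolve_le e _ _ _ _ (le_mergeBlocks _ _ _)
    fun _ => G.mergedBcl_arrow e _ _

/-- Merge-delete `e`: delete, and unite the two vertex classes at `e` as well. -/
noncomputable def mergeDel (G : PackagedArrowPresentation.{u}) (e : G.E) :
    PackagedArrowPresentation.{u} where
  toArrowPresentation := G.toArrowPresentation.delete e
  vcl := G.mergedVcl e
  vertexSetoid_le := G.vertexSetoid_resolve_le e _ _ _ _ (le_mergeBlocks _ _ _)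
    fun _ => G.mergedVcl_arrow e _ _
  bcl := G.mergedBcl e
  boundarySetoid_le := G.boundarySetoid_resolve_le e _ _ _ _ (le_mergeBlocks _ _ _)
    fun _ => G.mergedBcl_arrow e _ _

/-- Contract `e`: the two vertex classes at `e` are united (the vertices created by the contraction
lie in the united class), and the boundary partition is kept. -/
noncomputable def con (G : PackagedArrowPresentation.{u}) (e : G.E) :
    PackagedArrowPresentation.{u} where
  toArrowPresentation := G.toArrowPresentation.contract e
  vcl := G.mergedVcl e
  vertexSetoid_le := G.vertexSetoid_resolve_le e _ _ _ _ (le_mergeBlocks _ _ _)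
    fun _ => G.mergedVcl_arrow e _ _
  bcl := G.bcl
  boundarySetoid_le := by
    refine G.boundarySetoid_resolve_le e _ _ _ _ le_rfl ?_
    rintro ⟨i, _ | _⟩
    · have h := G.bcl_edge e (!i)
      rw [Bool.not_not] at h
      exact Setoid.symm' _ h
    · exact G.bcl_edge e i

/-- Merge-contract `e`: contract, and unite the two boundary classes at `e` as well. -/
noncomputable def mergeCon (G : PackagedArrowPresentation.{u}) (e : G.E) :
    PackagedArrowPresentation.{u} where
  toArrowPresentation := G.toArrowPresentation.contract e
  vcl := G.mergedVcl e
  vertexSetoid_le := G.vertexSetoid_resolve_le e _ _ _ _ (le_mergeBlocks _ _ _)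
    fun _ => G.mergedVcl_arrow e _ _
  bcl := G.mergedBcl e
  boundarySetoid_le := G.boundarySetoid_resolve_le e _ _ _ _ (le_mergeBlocks _ _ _)
    fun _ => G.mergedBcl_arrow e _ _

/-- Penrose-contract `e`: the two vertex classes at `e` are united, and so are the two boundary
classes at `e`. -/
noncomputable def penroseCon (G : PackagedArrowPresentation.{u}) (e : G.E) :
    PackagedArrowPresentation.{u} where
  toArrowPresentation := G.toArrowPresentation.penrose e
  vcl := G.mergedVcl e
  vertexSetoid_le := G.vertexSetoid_resolve_le e _ _ _ _ (le_mergeBlocks _ _ _)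
    fun _ => G.mergedVcl_arrow e _ _
  bcl := G.mergedBcl e
  boundarySetoid_le := G.boundarySetoid_resolve_le e _ _ _ _ (le_mergeBlocks _ _ _)
    fun _ => G.mergedBcl_arrow e _ _

/-- The vertex partition of a 2-sum: the class of the vertex carrying the first arrow of `f` is united
with the class of the vertex carrying the arrow of `e` coupled to it, and likewise for the second
arrow of `f`. -/
def twoSumVcl (G : PackagedArrowPresentation.{u}) (f : G.E) (H : PackagedArrowPresentation.{u})
    (e : H.E) (φ : Bool ≃ Bool) : Setoid (G.Pt ⊕ H.Pt) :=
  mergeBlocks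
    (mergeBlocks (sumPartition G.vcl H.vcl)
      (Sum.inl (G.tail f false)) (Sum.inr (H.tail e (φ false))))
    (Sum.inl (G.tail f true)) (Sum.inr (H.tail e (φ true)))

/-- The boundary partition of a 2-sum: the class of the boundary component containing the tail of the
first arrow of `f` (and the head of the second) is united with the class of the one containing the
tail of the coupled arrow, and likewise for the head of the first arrow (and the tail of the
second). -/
def twoSumBcl (G : PackagedArrowPresentation.{u}) (f : G.E) (H : PackagedArrowPresentation.{u})
    (e : H.E) (φ : Bool ≃ Bool) : Setoid (G.Pt ⊕ H.Pt) :=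
  mergeBlocks
    (mergeBlocks (sumPartition G.bcl H.bcl)
      (Sum.inl (G.tail f false)) (Sum.inr (H.tail e (φ false))))
    (Sum.inl (G.head f false)) (Sum.inr (H.head e (φ false)))

theorem twoSumVcl_inl (G : PackagedArrowPresentation.{u}) (f : G.E)
    (H : PackagedArrowPresentation.{u}) (e : H.E) (φ : Bool ≃ Bool) {x y : G.Pt}
    (h : G.vcl x y) : G.twoSumVcl f H e φ (Sum.inl x) (Sum.inl y) :=
  le_mergeBlocks _ _ _ (le_mergeBlocks _ _ _ (Sum.LiftRel.inl h))

theorem twoSumVcl_inr (G : PackagedArrowPresentation.{u}) (f : G.E)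
    (H : PackagedArrowPresentation.{u}) (e : H.E) (φ : Bool ≃ Bool) {x y : H.Pt}
    (h : H.vcl x y) : G.twoSumVcl f H e φ (Sum.inr x) (Sum.inr y) :=
  le_mergeBlocks _ _ _ (le_mergeBlocks _ _ _ (Sum.LiftRel.inr h))

theorem twoSumBcl_inl (G : PackagedArrowPresentation.{u}) (f : G.E)
    (H : PackagedArrowPresentation.{u}) (e : H.E) (φ : Bool ≃ Bool) {x y : G.Pt}
    (h : G.bcl x y) : G.twoSumBcl f H e φ (Sum.inl x) (Sum.inl y) :=
  le_mergeBlocks _ _ _ (le_mergeBlocks _ _ _ (Sum.LiftRel.inl h))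

theorem twoSumBcl_inr (G : PackagedArrowPresentation.{u}) (f : G.E)
    (H : PackagedArrowPresentation.{u}) (e : H.E) (φ : Bool ≃ Bool) {x y : H.Pt}
    (h : H.bcl x y) : G.twoSumBcl f H e φ (Sum.inr x) (Sum.inr y) :=
  le_mergeBlocks _ _ _ (le_mergeBlocks _ _ _ (Sum.LiftRel.inr h))

theorem twoSumVcl_coupled (G : PackagedArrowPresentation.{u}) (f : G.E)
    (H : PackagedArrowPresentation.{u}) (e : H.E) (φ : Bool ≃ Bool) (j : Bool × Bool) :
    G.twoSumVcl f H e φ (Sum.inl (G.arrow (f, j))) (Sum.inr (H.arrow (e, φ j.1, j.2))) := by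
  have ht : ∀ i, G.twoSumVcl f H e φ (Sum.inl (G.tail f i)) (Sum.inr (H.tail e (φ i))) := by
    rintro (_ | _)
    · exact le_mergeBlocks _ _ _ (mergeBlocks_rel _ _ _)
    · exact mergeBlocks_rel _ _ _
  rcases j with ⟨i, _ | _⟩
  · exact ht i
  · exact Setoid.trans' _ (Setoid.symm' _ (G.twoSumVcl_inl f H e φ (G.vcl_arrow f i)))
      (Setoid.trans' _ (ht i) (G.twoSumVcl_inr f H e φ (H.vcl_arrow e (φ i))))

theorem twoSumBcl_coupled (G : PackagedArrowPresentation.{u}) (f : G.E)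
    (H : PackagedArrowPresentation.{u}) (e : H.E) (φ : Bool ≃ Bool) (j : Bool × Bool) :
    G.twoSumBcl f H e φ (Sum.inl (G.arrow (f, j))) (Sum.inr (H.arrow (e, φ j.1, j.2))) := by
  have hφ : φ true = !φ false := by
    have : φ true ≠ φ false := fun h => by simpa using φ.injective h
    revert this
    cases φ true <;> cases φ false <;> simp
  have h1 : G.twoSumBcl f H e φ (Sum.inl (G.tail f false)) (Sum.inr (H.tail e (φ false))) :=
    le_mergeBlocks _ _ _ (mergeBlocks_rel _ _ _)
  have h2 : G.twoSumBcl f H e φ (Sum.inl (G.head f false)) (Sum.inr (H.head e (φ false))) :=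
    mergeBlocks_rel _ _ _
  rcases j with ⟨_ | _, _ | _⟩
  · exact h1
  · exact h2
  · have h3 := G.twoSumBcl_inl f H e φ (G.bcl_edge f false)
    have h4 := G.twoSumBcl_inr f H e φ (H.bcl_edge e (φ false))
    rw [← hφ] at h4
    exact Setoid.trans' _ (Setoid.symm' _ h3) (Setoid.trans' _ h2 h4)
  · have h3 := G.twoSumBcl_inl f H e φ (G.bcl_edge f true)
    have h4 := G.twoSumBcl_inr f H e φ (H.bcl_edge e (φ true))
    rw [hφ, Bool.not_not, ← hφ] at h4
    exact Setoid.trans' _ h3 (Setoid.trans' _ h1 (Setoid.symm' _ h4))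

/-- The 2-sum of packaged arrow presentations along `f` and `e` with respect to the coupling `φ`. -/
noncomputable def twoSum (G : PackagedArrowPresentation.{u}) (f : G.E)
    (H : PackagedArrowPresentation.{u}) (e : H.E) (φ : Bool ≃ Bool) :
    PackagedArrowPresentation.{u} where
  toArrowPresentation := G.toArrowPresentation.twoSum f H.toArrowPresentation e φ
  vcl := G.twoSumVcl f H e φ
  vertexSetoid_le := by
    refine Setoid.eqvGen_le ?_
    rintro x y (rfl | rfl | ⟨f' | f', i, rfl, rfl⟩)
    · rcases x with x | x
      · exact G.twoSumVcl_inl f H e φ (G.vcl_arc x)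
      · exact G.twoSumVcl_inr f H e φ (H.vcl_arc x)
    · rcases x with x | x
      · by_cases hx : ∃ j, G.arrow (f, j) = x
        · obtain ⟨j, rfl⟩ := hx
          rw [G.twoSum_join_inl_arrow f H.toArrowPresentation e φ j]
          exact G.twoSumVcl_coupled f H e φ j
        · rw [G.twoSum_join_inl_of_not f H.toArrowPresentation e φ x hx]
          exact G.twoSumVcl_inl f H e φ (G.vcl_join x)
      · by_cases hx : ∃ j : Bool × Bool, H.arrow (e, φ j.1, j.2) = x
        · obtain ⟨j, rfl⟩ := hx
          rw [G.twoSum_join_inr_arrow f H.toArrowPresentation e φ j]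
          exact Setoid.symm' _ (G.twoSumVcl_coupled f H e φ j)
        · rw [G.twoSum_join_inr_of_not f H.toArrowPresentation e φ x hx]
          exact G.twoSumVcl_inr f H e φ (H.vcl_join x)
    · exact G.twoSumVcl_inl f H e φ (G.vcl_arrow f'.1 i)
    · exact G.twoSumVcl_inr f H e φ (H.vcl_arrow f'.1 i)
  bcl := G.twoSumBcl f H e φ
  boundarySetoid_le := by
    refine Setoid.eqvGen_le ?_
    rintro x y (rfl | rfl | ⟨f' | f', i, rfl, rfl⟩)
    · rcases x with x | x
      · exact G.twoSumBcl_inl f H e φ (G.bcl_arc x)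
      · exact G.twoSumBcl_inr f H e φ (H.bcl_arc x)
    · rcases x with x | x
      · by_cases hx : ∃ j, G.arrow (f, j) = x
        · obtain ⟨j, rfl⟩ := hx
          rw [G.twoSum_join_inl_arrow f H.toArrowPresentation e φ j]
          exact G.twoSumBcl_coupled f H e φ j
        · rw [G.twoSum_join_inl_of_not f H.toArrowPresentation e φ x hx]
          exact G.twoSumBcl_inl f H e φ (G.bcl_join x)
      · by_cases hx : ∃ j : Bool × Bool, H.arrow (e, φ j.1, j.2) = x
        · obtain ⟨j, rfl⟩ := hx
          rw [G.twoSum_join_inr_arrow f H.toArrowPresentation e φ j]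
          exact Setoid.symm' _ (G.twoSumBcl_coupled f H e φ j)
        · rw [G.twoSum_join_inr_of_not f H.toArrowPresentation e φ x hx]
          exact G.twoSumBcl_inr f H e φ (H.bcl_join x)
    · exact G.twoSumBcl_inl f H e φ (G.bcl_edge f'.1 i)
    · exact G.twoSumBcl_inr f H e φ (H.bcl_edge f'.1 i)

open Classical in
/-- The edges of `l` other than `f`, as edges of a 2-sum along `f`. -/
noncomputable def remainingEdges (G : PackagedArrowPresentation.{u}) (f : G.E)
    (H : PackagedArrowPresentation.{u}) (e : H.E) (φ : Bool ≃ Bool) (l : List G.E) :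
    List (G.twoSum f H e φ).E :=
  l.filterMap fun f' => if h : f' ≠ f then some (Sum.inl ⟨f', h⟩) else none

/-- Starting with `G`, take the 2-sum with a new copy of `H` along each of the edges `f` in the list `l`
in turn, always along the edge `e` of the copy and with respect to the coupling `φ f`.  (An edge that
is repeated in `l` is only treated once.  The couplings at edges of copies of `H` are never used.)
When `l` lists all edges of `G`, this is the tensor product of `G` and `H`. -/
noncomputable def tensor (H : PackagedArrowPresentation.{u}) (e : H.E) :
    (G : PackagedArrowPresentation.{u}) → (φ : G.E → Bool ≃ Bool) → (l : List G.E) →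
      PackagedArrowPresentation.{u}
  | G, _, [] => G
  | G, φ, f :: l =>
    tensor H e (G.twoSum f H e (φ f)) (Sum.elim (fun f' => φ f'.1) fun _ => Equiv.refl Bool)
      (G.remainingEdges f H e (φ f) l)
termination_by _ _ l => l.length
decreasing_by
  exact Nat.lt_succ_of_le (List.length_filterMap_le _ _)

/-- The polynomial ring `ℤ[a, b, c, x, y, α, β, γ]`, with the variables numbered in this order. -/
abbrev QRing : Type := MvPolynomial (Fin 8) ℤ

theorem card_edges_lt (G : PackagedArrowPresentation.{u}) (e : G.E) :
    Nat.card {f : G.E // f ≠ e} < Nat.card G.E := by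
  have := G.finite_edges
  exact Finite.card_subtype_lt (p := fun f => f ≠ e) (x := e) (by simp)

/-- The defining properties of `Q`: the recursion holds at every edge, and the value at an edgeless
presentation is `α ^ |V| * β ^ |𝒱| * γ ^ |ℬ|`. -/
structure IsQ (F : PackagedArrowPresentation.{u} → QRing) : Prop where
  edge : ∀ (G : PackagedArrowPresentation.{u}) (e : G.E),
    F G = X 0 * F (G.del e) + X 1 * F (G.con e) + X 2 * F (G.penroseCon e) +
      X 3 * F (G.mergeDel e) + X 4 * F (G.mergeCon e)
  edgeless : ∀ G : PackagedArrowPresentation.{u}, IsEmpty G.E →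
    F G = X 5 ^ G.numVertices * X 6 ^ G.numVertexClasses * X 7 ^ G.numBoundaryClasses

open Classical in
/-- The polynomial `Q(G; a, b, c, x, y, α, β, γ)`, computed by resolving the edges one after the other
in an arbitrarily chosen order. -/
noncomputable def Q (G : PackagedArrowPresentation.{u}) : QRing :=
  if h : Nonempty G.E then
    X 0 * Q (G.del h.some) + X 1 * Q (G.con h.some) + X 2 * Q (G.penroseCon h.some) +
      X 3 * Q (G.mergeDel h.some) + X 4 * Q (G.mergeCon h.some)
  else X 5 ^ G.numVertices * X 6 ^ G.numVertexClasses * X 7 ^ G.numBoundaryClasses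
termination_by Nat.card G.E
decreasing_by all_goals exact G.card_edges_lt _

/-- The field `ℚ(a, b, c, x, y, α, β, γ)` of rational functions. -/
abbrev QField : Type := FractionRing QRing

/-- The `i`-th variable, as a rational function. -/
noncomputable def var (i : Fin 8) : QField := algebraMap QRing QField (X i)

/-- The matrix of the linear system, without the factor `αβγ`. -/
noncomputable def tensorMatrix : Matrix (Fin 5) (Fin 5) QField :=
  let α := var 5
  let β := var 6
  let γ := var 7
  !![α * β, 1, 1, α, 1;
     1, α * γ, 1, 1, α;
     1, 1, α, 1, 1;
     α, 1, 1, α, 1;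
     1, α, 1, 1, α]

/-- `ψ = (φ_(=,2), φ_(∥,2), φ_×, φ_(=,1), φ_(∥,1))` solves the linear system of `H` and `e`. -/
def IsTensorSolution (H : PackagedArrowPresentation.{u}) (e : H.E) (ψ : Fin 5 → QField) : Prop :=
  ((var 5 * var 6 * var 7) • tensorMatrix).mulVec ψ =
    ![algebraMap QRing QField (Q (H.del e)),
      algebraMap QRing QField (Q (H.con e)),
      algebraMap QRing QField (Q (H.penroseCon e)),
      algebraMap QRing QField (Q (H.mergeDel e)),
      algebraMap QRing QField (Q (H.mergeCon e))]

end PackagedArrowPresentation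

/-! Applying the recursion at every edge turns `Q` into a state sum. A state assigns one of the five
operations to each edge; its contribution is the product of the weights times a monomial in α, β, γ
counting the blocks of three partitions of the set of points: the strands (circles with the arrows
left out), the vertex classes and the boundary classes, each united at every edge as the chosen
operation prescribes for the four end points (`arcPairing`, `vertexPairing`, `boundaryPairing`). No
order of the edges enters, so the sum satisfies the recursion at every edge (`isQ_stateSum`);
uniqueness is induction on the number of edges. The weights are allowed to vary with the edge, since
the tensor product is treated one edge at a time.

The heart is `exists_pairing`. Fix a state of the edges of `H` other than `e` and look at the traces
of the three partitions on the four end points of `e`. The strands ending there are paths, so they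
match the end points in pairs, in one of three ways. The vertex trace contains this matching and the
one that joins the ends of each arrow; the boundary trace contains it and the one that joins each
head to the opposite tail. A partition containing two different perfect matchings of four points is
trivial, so only five triples of traces remain, those of the five operations.

Blocks of `H` that miss the end points of `e` give a factor that depends neither on how `e` is
resolved nor on what is glued in its place (`card_quotient_sup_map`, `card_quotient_gluePartition`).
Thus a state of type `j` acts as operation `j` on a single edge, up to a factor. The total weights
`ψ j` of the states of type `j` therefore solve the linear system, whose `(i, j)` entry is the
monomial of operation `i` against connections `j`, and a 2-sum along `f` amounts to giving `f` the
weights `ψ` (`exists_stateSum_twoSum_eq`). The matrix is injective, so `ψ` is the only solution, and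
replacing the edges of `G` in turn gives the formula. -/

/-! ### Partitions glued along marked points -/

section Setoid

theorem Setoid.map_le_iff_le_comap {X Y : Type*} (r : Setoid X) (f : X → Y) (s : Setoid Y) :
    r.map f ≤ s ↔ r ≤ s.comap f := by
  refine ⟨fun h => Setoid.le_comap_map.trans fun x y hxy => h hxy, fun h => Setoid.eqvGen_le ?_⟩
  rintro _ _ ⟨x, y, hxy, rfl, rfl⟩
  exact h hxy

theorem Setoid.map_rel {X Y : Type*} (r : Setoid X) (f : X → Y) {x y : X} (h : r x y) :
    r.map f (f x) (f y) :=
  (Setoid.map_le_iff_le_comap r f _).1 le_rfl h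

/-- The disjoint union of two partitioned sets, with `i j` and `k j` identified for every `j`. -/
def gluePartition {J : Type*} {X Y : Type u} (r : Setoid X) (s : Setoid Y) (i : J → X)
    (k : J → Y) : Setoid (X ⊕ Y) :=
  sumPartition r s ⊔
    Relation.EqvGen.setoid fun x y => ∃ j, x = Sum.inl (i j) ∧ y = Sum.inr (k j)

section gluePartition

variable {J : Type*} {X Y : Type u} {r : Setoid X} {s : Setoid Y} {i : J → X} {k : J → Y}

theorem gluePartition_inl {x x' : X} (h : r x x') :
    gluePartition r s i k (Sum.inl x) (Sum.inl x') :=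
  (le_sup_left : _ ≤ gluePartition r s i k) (Sum.LiftRel.inl h)

theorem gluePartition_inr {y y' : Y} (h : s y y') :
    gluePartition r s i k (Sum.inr y) (Sum.inr y') :=
  (le_sup_left : _ ≤ gluePartition r s i k) (Sum.LiftRel.inr h)

theorem gluePartition_inl_inr (j : J) :
    gluePartition r s i k (Sum.inl (i j)) (Sum.inr (k j)) :=
  (le_sup_right : _ ≤ gluePartition r s i k) (Relation.EqvGen.rel _ _ ⟨j, rfl, rfl⟩)

theorem gluePartition_le {t : Setoid (X ⊕ Y)} (hr : ∀ x x', r x x' → t (Sum.inl x) (Sum.inl x'))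
    (hs : ∀ y y', s y y' → t (Sum.inr y) (Sum.inr y'))
    (h : ∀ j, t (Sum.inl (i j)) (Sum.inr (k j))) : gluePartition r s i k ≤ t := by
  refine sup_le ?_ (Setoid.eqvGen_le ?_)
  · rintro _ _ (⟨h⟩ | ⟨h⟩)
    · exact hr _ _ h
    · exact hs _ _ h
  · rintro _ _ ⟨j, rfl, rfl⟩
    exact h j

end gluePartition

/-- The blocks of `s` that contain none of the points `k j`. -/
def FreeBlock {J Y : Type*} (s : Setoid Y) (k : J → Y) : Type _ :=
  {c : Quotient s // ∀ j, c ≠ Quotient.mk s (k j)}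

open Classical in
/-- A block of `s` through a marked point `k j` is sent to the block of `i j`; the other blocks are
kept. -/
noncomputable def transferBlock {J : Type*} {X Y : Type*} (r : Setoid X) (s : Setoid Y)
    (i : J → X) (k : J → Y) (y : Y) :
    FreeBlock s k ⊕ Quotient (r ⊔ (s.comap k).map i) :=
  if h : ∃ j, s y (k j) then Sum.inr (Quotient.mk _ (i h.choose))
  else Sum.inl ⟨Quotient.mk _ y, fun j hj => h ⟨j, Quotient.exact hj⟩⟩

section transferBlock

variable {J : Type*} {X Y : Type*} (r : Setoid X) (s : Setoid Y) (i : J → X) (k : J → Y)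

/-- The choice of the marked point does not matter: two indices whose marked points share a block of
`s` are related by `s.comap k`, and its image under `i` is part of the target partition. -/
theorem transferBlock_of_rel {y : Y} {j : J} (h : s y (k j)) :
    transferBlock r s i k y = Sum.inr (Quotient.mk _ (i j)) := by
  have h' : ∃ j, s y (k j) := ⟨j, h⟩
  rw [transferBlock, dif_pos h']
  refine congrArg Sum.inr (Quotient.sound ?_)
  refine (le_sup_right : _ ≤ r ⊔ (s.comap k).map i) (Setoid.map_rel _ _ ?_)
  exact s.trans' (s.symm' h'.choose_spec) h

theorem transferBlock_of_not {y : Y} (h : ¬∃ j, s y (k j)) :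
    transferBlock r s i k y =
      Sum.inl ⟨Quotient.mk _ y, fun j hj => h ⟨j, Quotient.exact hj⟩⟩ :=
  dif_neg h

theorem transferBlock_congr {y y' : Y} (h : s y y') :
    transferBlock r s i k y = transferBlock r s i k y' := by
  by_cases hy : ∃ j, s y' (k j)
  · obtain ⟨j, hj⟩ := hy
    rw [transferBlock_of_rel r s i k hj, transferBlock_of_rel r s i k (s.trans' h hj)]
  · have hy' : ¬∃ j, s y (k j) := fun ⟨j, hj⟩ => hy ⟨j, s.trans' (s.symm' h) hj⟩
    rw [transferBlock_of_not r s i k hy, transferBlock_of_not r s i k hy']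
    exact congrArg Sum.inl (Subtype.ext (Quotient.sound h))

end transferBlock

/-- A glued block either meets `X` or is a block of `s` without marked points. On `X` the gluing is
felt only through the trace `s.comap k`, so `s` enters the count through this trace and its number
of free blocks alone. -/
theorem card_quotient_gluePartition {J : Type*} {X Y : Type u} [Finite X] [Finite Y]
    (r : Setoid X) (s : Setoid Y) (i : J → X) (k : J → Y) :
    Nat.card (Quotient (gluePartition r s i k)) =
      Nat.card (FreeBlock s k) + Nat.card (Quotient (r ⊔ (s.comap k).map i)) := by
  have : Finite (FreeBlock s k) := Subtype.finite
  rw [← Nat.card_sum]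
  have hle : gluePartition r s i k ≤ Setoid.ker
      (Sum.elim (fun x => Sum.inr (Quotient.mk (r ⊔ (s.comap k).map i) x))
        (transferBlock r s i k)) := by
    refine gluePartition_le (fun x x' h => ?_) (fun y y' h => ?_) fun j => ?_
    · exact congrArg Sum.inr (Quotient.sound ((le_sup_left : r ≤ r ⊔ (s.comap k).map i) h))
    · exact transferBlock_congr r s i k h
    · exact (transferBlock_of_rel r s i k (s.refl' _)).symm
  have hle' : r ⊔ (s.comap k).map i ≤ (gluePartition r s i k).comap Sum.inl := by
    refine sup_le (fun x y h => gluePartition_inl h) ((Setoid.map_le_iff_le_comap _ _ _).2 ?_)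
    intro j j' h
    exact (gluePartition r s i k).trans' (gluePartition_inl_inr j)
      ((gluePartition r s i k).trans' (gluePartition_inr h)
        ((gluePartition r s i k).symm' (gluePartition_inl_inr j')))
  refine Nat.card_congr
    { toFun := Quotient.lift _ fun _ _ h => hle h
      invFun := Sum.elim
        (fun c => Quotient.lift (fun y => Quotient.mk (gluePartition r s i k) (Sum.inr y))
          (fun _ _ h => Quotient.sound (gluePartition_inr h)) c.1)
        (Quotient.lift (fun x => Quotient.mk (gluePartition r s i k) (Sum.inl x))
          fun _ _ h => Quotient.sound (hle' h))
      left_inv := ?_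
      right_inv := ?_ }
  · rintro ⟨x | y⟩
    · rfl
    · change Sum.elim _ _ (transferBlock r s i k y) = _
      by_cases hy : ∃ j, s y (k j)
      · obtain ⟨j, hj⟩ := hy
        rw [transferBlock_of_rel r s i k hj]
        exact Quotient.sound (Setoid.trans' _ (gluePartition_inl_inr j)
          (gluePartition_inr (s.symm' hj)))
      · rw [transferBlock_of_not r s i k hy]
        rfl
  · rintro (⟨⟨y⟩, hy⟩ | x)
    · exact transferBlock_of_not r s i k fun ⟨j, hj⟩ => hy j (Quotient.sound hj)
    · induction x using Quotient.inductionOn with | _ x => rfl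

/-- Uniting blocks at the marked points leaves the free blocks alone, and the other blocks are
determined on the index set. The number of free blocks is the same as in
`card_quotient_gluePartition`, which makes resolving `e` comparable with gluing along it. -/
theorem card_quotient_sup_map {J Y : Type*} [Finite J] [Finite Y] (r : Setoid J) (s : Setoid Y)
    (k : J → Y) :
    Nat.card (Quotient (s ⊔ r.map k)) =
      Nat.card (FreeBlock s k) + Nat.card (Quotient (r ⊔ s.comap k)) := by
  have : Finite (FreeBlock s k) := Subtype.finite
  -- This is the target partition of `transferBlock` with the index set in the role of `X` and `i =
  -- id`.
  have hid : r ⊔ s.comap k = r ⊔ (s.comap k).map id := by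
    congr 1
    refine le_antisymm ?_ ((Setoid.map_le_iff_le_comap _ _ _).2 le_rfl)
    exact fun _ _ h => Setoid.map_rel _ id h
  rw [hid, ← Nat.card_sum]
  have hle : s ⊔ r.map k ≤ Setoid.ker (transferBlock r s id k) := by
    refine sup_le (fun y y' h => transferBlock_congr r s id k h)
      ((Setoid.map_le_iff_le_comap _ _ _).2 fun j j' h => ?_)
    change transferBlock r s id k (k j) = transferBlock r s id k (k j')
    rw [transferBlock_of_rel r s id k (s.refl' (k j)),
      transferBlock_of_rel r s id k (s.refl' (k j'))]
    exact congrArg Sum.inr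
      (Quotient.sound ((le_sup_left : r ≤ r ⊔ (s.comap k).map id) h))
  have hle' : r ⊔ (s.comap k).map id ≤ (s ⊔ r.map k).comap k := by
    refine sup_le ((Setoid.map_le_iff_le_comap _ _ _).1 le_sup_right)
      ((Setoid.map_le_iff_le_comap _ _ _).2 fun j j' h => ?_)
    exact (le_sup_left : s ≤ s ⊔ r.map k) h
  refine Nat.card_congr
    { toFun := Quotient.lift _ fun _ _ h => hle h
      invFun := Sum.elim
        (fun c => Quotient.lift (fun y => Quotient.mk (s ⊔ r.map k) y)
          (fun _ _ h => Quotient.sound ((le_sup_left : s ≤ s ⊔ r.map k) h)) c.1)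
        (Quotient.lift (fun j => Quotient.mk (s ⊔ r.map k) (k j))
          fun _ _ h => Quotient.sound (hle' h))
      left_inv := ?_
      right_inv := ?_ }
  · rintro ⟨y⟩
    change Sum.elim _ _ (transferBlock r s id k y) = _
    by_cases hy : ∃ j, s y (k j)
    · obtain ⟨j, hj⟩ := hy
      rw [transferBlock_of_rel r s id k hj]
      exact Quotient.sound ((le_sup_left : s ≤ s ⊔ r.map k) (s.symm' hj))
    · rw [transferBlock_of_not r s id k hy]
      rfl
  · rintro (⟨⟨y⟩, hy⟩ | x)
    · exact transferBlock_of_not r s id k fun ⟨j, hj⟩ => hy j (Quotient.sound hj)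
    · induction x using Quotient.inductionOn with | _ j =>
      exact transferBlock_of_rel r s id k (s.refl' (k j))

end Setoid

/-! ### Orbits of two involutions -/

/-- In an orbit of two involutions `σ` and `τ`, `σ` without fixed points, the fixed points of `τ` come
in pairs: they are the ends of a path. -/
theorem existsUnique_fixed_ne_of_involutions {Y : Type*} [Finite Y] {σ τ : Y → Y}
    (hσ : ∀ y, σ (σ y) = y) (hσ' : ∀ y, σ y ≠ y) (hτ : ∀ y, τ (τ y) = y) {x : Y}
    (hx : τ x = x) :
    ∃! y, y ≠ x ∧ τ y = y ∧ Relation.EqvGen.setoid (fun y z => z = σ y ∨ z = τ y) x y := by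
  let S : Equiv.Perm Y := ⟨σ, σ, hσ, hσ⟩
  let T : Equiv.Perm Y := ⟨τ, τ, hτ, hτ⟩
  have hSS : S * S = 1 := Equiv.ext hσ
  have hTT : T * T = 1 := Equiv.ext hτ
  have hS : S⁻¹ = S := inv_eq_of_mul_eq_one_left hSS
  have hT : T⁻¹ = T := inv_eq_of_mul_eq_one_left hTT
  -- The two involutions generate a dihedral group with rotation `P`. As `τ` fixes `x`, the orbit of
  -- `x` consists of the points `P ^ n x`, on which `τ` acts by `n ↦ -n` and `σ` by `n ↦ 1 - n`,
  -- modulo the period `N`.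
  set P : Equiv.Perm Y := S * T with hP
  set N := MulAction.period P x with hN
  have hNpos : 0 < N := MulAction.period_pos_of_orderOf_pos (isOfFinOrder_of_finite P).orderOf_pos x
  have hfix : ∀ n : ℤ, (P ^ n) x = x ↔ (N : ℤ) ∣ n := fun n => by
    rw [← Equiv.Perm.smul_def]
    exact MulAction.zpow_smul_eq_iff_period_dvd
  have hinj : ∀ m n : ℤ, (P ^ m) x = (P ^ n) x ↔ (N : ℤ) ∣ m - n := by
    intro m n
    rw [← hfix, sub_eq_neg_add, zpow_add, Equiv.Perm.mul_apply, zpow_neg,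
      Equiv.Perm.inv_eq_iff_eq]
  have hTP : T * P * T⁻¹ = P⁻¹ := by
    rw [hP, mul_inv_rev, hT, hS, mul_assoc, mul_assoc, hTT, mul_one]
  have hτP : ∀ n : ℤ, τ ((P ^ n) x) = (P ^ (-n)) x := by
    intro n
    have h1 : T * P ^ n * T⁻¹ = P ^ (-n) := by rw [← conj_zpow, hTP, inv_zpow']
    have h2 : T * P ^ n = P ^ (-n) * T := by rw [← h1]; group
    have h3 := congrArg (fun g : Equiv.Perm Y => g x) h2
    change τ ((P ^ n) x) = (P ^ (-n)) (τ x) at h3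
    rw [h3, hx]
  have hσP : ∀ n : ℤ, σ ((P ^ n) x) = (P ^ (1 - n)) x := by
    intro n
    rw [sub_eq_add_neg, zpow_add, zpow_one, Equiv.Perm.mul_apply, ← hτP]
    change _ = σ (τ (τ _))
    rw [hτ]
  have hrel : ∀ n : ℤ, Relation.EqvGen.setoid (fun y z => z = σ y ∨ z = τ y) x ((P ^ n) x) := by
    have step : ∀ y, Relation.EqvGen.setoid (fun y z => z = σ y ∨ z = τ y) y (P y) := fun y =>
      Setoid.trans' _ (Relation.EqvGen.rel _ _ (Or.inr rfl)) (Relation.EqvGen.rel _ _ (Or.inl rfl))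
    intro n
    induction n using Int.induction_on with
    | zero => exact Setoid.refl' _ _
    | succ n ih =>
      refine Setoid.trans' _ ih ?_
      rw [add_comm, zpow_add, zpow_one]
      exact step _
    | pred n ih =>
      refine Setoid.trans' _ ih (Setoid.symm' _ ?_)
      have h := step ((P ^ (-(n : ℤ) - 1)) x)
      rwa [← Equiv.Perm.mul_apply, ← zpow_one_add, add_sub_cancel] at h
  have horb : ∀ y, Relation.EqvGen.setoid (fun y z => z = σ y ∨ z = τ y) x y →
      ∃ n : ℤ, y = (P ^ n) x := by
    have key : Relation.EqvGen.setoid (fun y z => z = σ y ∨ z = τ y) ≤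
        Setoid.ker fun y => ∃ n : ℤ, y = (P ^ n) x := by
      refine Setoid.eqvGen_le ?_
      rintro y _ (rfl | rfl) <;> refine propext ⟨?_, ?_⟩ <;> rintro ⟨n, h⟩
      · exact ⟨1 - n, by rw [h, hσP]⟩
      · exact ⟨1 - n, by rw [← hσP, ← h, hσ]⟩
      · exact ⟨-n, by rw [h, hτP]⟩
      · exact ⟨-n, by rw [← hτP, ← h, hτ]⟩
    intro y hy
    have h := key hy
    exact cast h ⟨0, rfl⟩
  -- For odd `N = 2 * m + 1` the reflection `n ↦ 1 - n` would fix `m + 1` modulo `N`, but `σ` has no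
  -- fixed points.
  obtain ⟨m, hm⟩ : ∃ m : ℕ, N = 2 * m := by
    rcases Nat.even_or_odd' N with ⟨m, hm | hm⟩
    · exact ⟨m, hm⟩
    · refine absurd ?_ (hσ' ((P ^ ((m : ℤ) + 1)) x))
      rw [hσP, hinj, hm]
      exact ⟨-1, by push_cast; ring⟩
  -- Modulo `2 * m` the fixed points of `n ↦ -n` are `0`, which is `x` itself, and `m`.
  refine ⟨(P ^ (m : ℤ)) x, ⟨?_, ?_, hrel _⟩, ?_⟩
  · rw [Ne, hfix, hm]
    intro h
    have := Int.le_of_dvd (by omega) h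
    push_cast at this
    omega
  · rw [hτP, hinj, hm]
    exact ⟨-1, by push_cast; ring⟩
  · rintro y ⟨hyx, hy, hxy⟩
    obtain ⟨n, rfl⟩ := horb y hxy
    rw [hτP, hinj, hm] at hy
    obtain ⟨q, hq⟩ := hy
    have hq' : n = m * -q := by push_cast at hq; linarith
    rw [Ne, hfix, hm] at hyx
    rw [hinj, hm]
    rcases Int.even_or_odd' (-q) with ⟨p, hp | hp⟩
    · exact absurd ⟨p, by rw [hq', hp]; push_cast; ring⟩ hyx
    · exact ⟨p, by rw [hq', hp]; push_cast; ring⟩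

/-! ### Weighted sums over states -/

section weightedSum

open Classical in
/-- The state with value `i` at `e` and values `s` elsewhere. -/
noncomputable def insertState {E S : Type*} (e : E) (i : S) (s : {f // f ≠ e} → S) (f : E) : S :=
  if h : f = e then i else s ⟨f, h⟩

theorem insertState_self {E S : Type*} (e : E) (i : S) (s : {f // f ≠ e} → S) :
    insertState e i s e = i :=
  dif_pos rfl

theorem insertState_of_ne {E S : Type*} (e : E) (i : S) (s : {f // f ≠ e} → S) (f : {f // f ≠ e}) :
    insertState e i s f.1 = s f :=
  dif_neg f.2

variable {E S R : Type*} [Finite E] [Fintype S] [CommSemiring R]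

open Classical in
/-- The sum of `t` over all states `E → S`, each state weighted with the product of the weights of its
values. -/
noncomputable def weightedSum (w : E → S → R) (t : (E → S) → R) : R :=
  letI := Fintype.ofFinite E
  ∑ s : E → S, (∏ e, w e (s e)) * t s

theorem weightedSum_eq [Fintype E] [DecidableEq E] (w : E → S → R) (t : (E → S) → R) :
    weightedSum w t = ∑ s : E → S, (∏ e, w e (s e)) * t s := by
  rw [weightedSum, Subsingleton.elim (Fintype.ofFinite E) ‹_›]
  congr!

theorem weightedSum_of_isEmpty [IsEmpty E] (w : E → S → R) (t : (E → S) → R) :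
    weightedSum w t = t isEmptyElim := by
  classical
  let _ := Fintype.ofFinite E
  rw [weightedSum_eq, Fintype.sum_unique, Fintype.prod_empty, one_mul,
    Subsingleton.elim default (isEmptyElim : E → S)]

theorem weightedSum_split (e : E) (w : E → S → R) (t : (E → S) → R) :
    weightedSum w t = ∑ i, w e i *
      weightedSum (fun f : {f // f ≠ e} => w f.1) fun s => t (insertState e i s) := by
  classical
  let _ := Fintype.ofFinite E
  simp only [weightedSum_eq, Finset.mul_sum]
  rw [← Fintype.sum_prod_type', ← (Equiv.funSplitAt e S).symm.sum_comp]
  refine Finset.sum_congr rfl fun p _ => ?_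
  have h : (Equiv.funSplitAt e S).symm p = insertState e p.1 p.2 := by
    funext f
    by_cases hf : f = e
    · subst hf
      simp [insertState_self]
    · rw [insertState_of_ne e p.1 p.2 ⟨f, hf⟩]
      simp [hf]
  rw [h, ← mul_assoc]
  congr 1
  have hc : ∏ f ∈ ({e}ᶜ : Finset E), w f (insertState e p.1 p.2 f) =
      ∏ f : {f // f ≠ e}, w f.1 (p.2 f) := by
    rw [Finset.prod_subtype (p := fun f => f ≠ e) _ (by simp)]
    exact Finset.prod_congr rfl fun f _ => by rw [insertState_of_ne]
  rw [Fintype.prod_eq_mul_prod_compl e, insertState_self, hc]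

theorem weightedSum_sum {F : Type*} [Finite F] (w : E → S → R) (v : F → S → R)
    (t : (E ⊕ F → S) → R) :
    weightedSum (Sum.elim w v) t =
      weightedSum w fun s => weightedSum v fun s' => t (Sum.elim s s') := by
  classical
  let _ := Fintype.ofFinite E
  let _ := Fintype.ofFinite F
  simp only [weightedSum_eq, Finset.mul_sum]
  rw [← Fintype.sum_prod_type', ← (Equiv.sumArrowEquivProdArrow E F S).symm.sum_comp]
  refine Finset.sum_congr rfl fun p _ => ?_
  rw [← mul_assoc, Fintype.prod_sum_type]
  rfl

theorem weightedSum_mul_right (w : E → S → R) (t : (E → S) → R) (c : R) :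
    weightedSum w (fun s => t s * c) = weightedSum w t * c := by
  simp only [weightedSum, Finset.sum_mul, mul_assoc]

theorem weightedSum_finset_sum {ι : Type*} (A : Finset ι) (w : E → S → R)
    (t : ι → (E → S) → R) :
    weightedSum w (fun s => ∑ i ∈ A, t i s) = ∑ i ∈ A, weightedSum w (t i) := by
  simp only [weightedSum, Finset.mul_sum]
  exact Finset.sum_comm

theorem map_weightedSum {R' F : Type*} [CommSemiring R'] [FunLike F R R'] [RingHomClass F R R']
    (g : F) (w : E → S → R) (t : (E → S) → R) :
    g (weightedSum w t) = weightedSum (fun e i => g (w e i)) fun s => g (t s) := by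
  simp only [weightedSum, map_sum, map_mul, map_prod]

end weightedSum

/-! ### The partitions of the four end points of an edge -/

/-- Two end points of an edge have the same color if they belong to the same pair of `arcPairing`. -/
def pairingColor : Fin 5 → Bool × Bool → Bool :=
  ![Prod.fst, fun j => xor j.1 j.2, Prod.snd, Prod.fst, fun j => xor j.1 j.2]

/-- How the four end points of an edge are paired up by deletion, contraction, Penrose-contraction,
merge-deletion and merge-contraction, in this order. -/
def arcPairing (i : Fin 5) : Setoid (Bool × Bool) :=
  Setoid.ker (pairingColor i)

/-- Which end points of an edge are in the same vertex class after each of the five operations. -/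
def vertexPairing (i : Fin 5) : Setoid (Bool × Bool) :=
  if i = 0 then Setoid.ker Prod.fst else ⊤

/-- Which end points of an edge are in the same boundary class after each of the five operations. -/
def boundaryPairing (i : Fin 5) : Setoid (Bool × Bool) :=
  if i = 1 then Setoid.ker fun j => xor j.1 j.2 else ⊤

theorem arcPairing_le_vertexPairing (i : Fin 5) : arcPairing i ≤ vertexPairing i := by
  by_cases h : i = 0
  · subst h
    exact le_rfl
  · rw [vertexPairing, if_neg h]
    exact le_top

theorem arcPairing_le_boundaryPairing (i : Fin 5) : arcPairing i ≤ boundaryPairing i := by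
  by_cases h : i = 1
  · subst h
    exact le_rfl
  · rw [boundaryPairing, if_neg h]
    exact le_top

/-! ### Strands, and uniting blocks at edges -/

namespace ArrowPresentation

instance (G : ArrowPresentation.{u}) : Finite G.Pt := G.finite_pt

instance (G : ArrowPresentation.{u}) : Finite G.E := G.finite_edges

/-- The components of the union of the arcs outside the arrows. -/
def strandSetoid (G : ArrowPresentation.{u}) : Setoid G.Pt :=
  Relation.EqvGen.setoid fun x y => y = G.arc x ∨ y = G.join x

theorem strandSetoid_arc (G : ArrowPresentation.{u}) (x : G.Pt) : G.strandSetoid x (G.arc x) :=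
  Relation.EqvGen.rel _ _ (Or.inl rfl)

theorem strandSetoid_join (G : ArrowPresentation.{u}) (x : G.Pt) :
    G.strandSetoid x (G.join x) :=
  Relation.EqvGen.rel _ _ (Or.inr rfl)

theorem strandSetoid_le (G : ArrowPresentation.{u}) {r : Setoid G.Pt} (h : ∀ x, r x (G.arc x))
    (h' : ∀ x, r x (G.join x)) : G.strandSetoid ≤ r := by
  refine Setoid.eqvGen_le ?_
  rintro x _ (rfl | rfl)
  · exact h x
  · exact h' x

theorem join_arrow (G : ArrowPresentation.{u}) (p : G.E × Bool × Bool) :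
    G.join (G.arrow p) = G.arrow p :=
  (G.join_eq_self_iff _).2 ⟨p, rfl⟩

/-- In `G` the end points of `e` are fixed by `join`, so rejoining them by `ρ` destroys no
connection and only adds the pairs of `ρ`. For circles this fails, since their connections along the
arrows may be lost; hence the use of strands. -/
theorem strandSetoid_resolve (G : ArrowPresentation.{u}) (e : G.E)
    (ρ : Bool × Bool → Bool × Bool) (hρ : ∀ j, ρ (ρ j) = j) (hρ' : ∀ j, ρ j ≠ j)
    (r : Setoid (Bool × Bool)) (hr : ∀ j j', r j j' ↔ j' = j ∨ j' = ρ j) :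
    (G.resolve e ρ hρ hρ').strandSetoid =
      G.strandSetoid ⊔ r.map fun j => G.arrow (e, j) := by
  refine le_antisymm (strandSetoid_le _ (fun x => ?_) fun x => ?_) (sup_le
    (G.strandSetoid_le (fun x => ?_) fun x => ?_)
    ((Setoid.map_le_iff_le_comap _ _ _).2 fun j j' h => ?_))
  · exact (le_sup_left : G.strandSetoid ≤ _) (G.strandSetoid_arc x)
  · by_cases hx : ∃ j, G.arrow (e, j) = x
    · obtain ⟨j, rfl⟩ := hx
      rw [G.resolve_join_arrow e ρ hρ hρ' j]
      exact (le_sup_right : _ ≤ G.strandSetoid ⊔ r.map fun j => G.arrow (e, j))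
        (Setoid.map_rel r (fun j => G.arrow (e, j)) ((hr _ _).2 (Or.inr rfl)))
    · rw [G.resolve_join_of_not e ρ hρ hρ' x hx]
      exact (le_sup_left : G.strandSetoid ≤ _) (G.strandSetoid_join x)
  · exact (G.resolve e ρ hρ hρ').strandSetoid_arc x
  · by_cases hx : ∃ j, G.arrow (e, j) = x
    · obtain ⟨j, rfl⟩ := hx
      rw [G.join_arrow]
      exact Setoid.refl' _ _
    · rw [← G.resolve_join_of_not e ρ hρ hρ' x hx]
      exact (G.resolve e ρ hρ hρ').strandSetoid_join x
  · change (G.resolve e ρ hρ hρ').strandSetoid (G.arrow (e, j)) (G.arrow (e, j'))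
    rcases (hr j j').1 h with rfl | rfl
    · exact Setoid.refl' _ _
    · rw [← G.resolve_join_arrow e ρ hρ hρ' j]
      exact (G.resolve e ρ hρ hρ').strandSetoid_join _

theorem strandSetoid_eq_vertexSetoid (G : ArrowPresentation.{u}) [IsEmpty G.E] :
    G.strandSetoid = G.vertexSetoid := by
  refine le_antisymm (G.strandSetoid_le (fun x => Relation.EqvGen.rel _ _ (Or.inl rfl))
    fun x => Relation.EqvGen.rel _ _ (Or.inr (Or.inl rfl))) (Setoid.eqvGen_le ?_)
  rintro x _ (rfl | rfl | ⟨e, -⟩)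
  · exact G.strandSetoid_arc x
  · exact G.strandSetoid_join x
  · exact isEmptyElim e

/-- The partition obtained from `r` by uniting blocks at each edge `f` in the range of `ι` as
prescribed by `P`. -/
def uniteAt {F : Type*} (G : ArrowPresentation.{u}) (ι : F → G.E) (r : Setoid G.Pt)
    (P : F → Setoid (Bool × Bool)) : Setoid G.Pt :=
  r ⊔ ⨆ f, (P f).map fun j => G.arrow (ι f, j)

theorem uniteAt_insertState (G : ArrowPresentation.{u}) (e : G.E) (r : Setoid G.Pt)
    (P : Fin 5 → Setoid (Bool × Bool)) (i : Fin 5) (s : {f // f ≠ e} → Fin 5) :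
    G.uniteAt id r (fun f => P (insertState e i s f)) =
      G.uniteAt Subtype.val r (fun f => P (s f)) ⊔ (P i).map fun j => G.arrow (e, j) := by
  rw [uniteAt, uniteAt, iSup_split_single _ e, insertState_self, sup_assoc, sup_comm (iSup _)]
  simp only [iSup_subtype', id]
  congr! 6 with f
  exact insertState_of_ne e i s f

/-- Separates what happens at `e` from what happens at the other edges. -/
theorem uniteAt_sup {F : Type*} (G : ArrowPresentation.{u}) (ι : F → G.E) (r r' : Setoid G.Pt)
    (P : F → Setoid (Bool × Bool)) :
    G.uniteAt ι (r ⊔ r') P = G.uniteAt ι r P ⊔ r' := by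
  rw [uniteAt, uniteAt, sup_right_comm]

end ArrowPresentation

/-! ### State terms and state sums -/

namespace PackagedArrowPresentation

theorem mergedVcl_eq (G : PackagedArrowPresentation.{u}) (e : G.E) :
    G.mergedVcl e = G.vcl ⊔ (⊤ : Setoid (Bool × Bool)).map fun j => G.arrow (e, j) := by
  refine le_antisymm (sup_le le_sup_left (Setoid.eqvGen_le ?_))
    (sup_le (le_mergeBlocks _ _ _) ((Setoid.map_le_iff_le_comap _ _ _).2 fun j j' _ =>
      G.mergedVcl_arrow e j j'))
  rintro _ _ ⟨rfl, rfl⟩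
  exact (le_sup_right : _ ≤ G.vcl ⊔ (⊤ : Setoid (Bool × Bool)).map fun j => G.arrow (e, j))
    (Setoid.map_rel ⊤ (fun j => G.arrow (e, j)) (x := (false, false)) (y := (true, false)) trivial)

theorem mergedBcl_eq (G : PackagedArrowPresentation.{u}) (e : G.E) :
    G.mergedBcl e = G.bcl ⊔ (⊤ : Setoid (Bool × Bool)).map fun j => G.arrow (e, j) := by
  refine le_antisymm (sup_le le_sup_left (Setoid.eqvGen_le ?_))
    (sup_le (le_mergeBlocks _ _ _) ((Setoid.map_le_iff_le_comap _ _ _).2 fun j j' _ =>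
      G.mergedBcl_arrow e j j'))
  rintro _ _ ⟨rfl, rfl⟩
  exact (le_sup_right : _ ≤ G.bcl ⊔ (⊤ : Setoid (Bool × Bool)).map fun j => G.arrow (e, j))
    (Setoid.map_rel ⊤ (fun j => G.arrow (e, j)) (x := (false, false)) (y := (false, true)) trivial)

theorem ker_fst_le_comap_vcl (G : PackagedArrowPresentation.{u}) (e : G.E) :
    Setoid.ker Prod.fst ≤ G.vcl.comap fun j => G.arrow (e, j) := by
  rintro ⟨i, _ | _⟩ ⟨i', _ | _⟩ (rfl : i = i')
  · exact Setoid.refl' _ _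
  · exact G.vcl_arrow e i
  · exact Setoid.symm' _ (G.vcl_arrow e i)
  · exact Setoid.refl' _ _

theorem ker_xor_le_comap_bcl (G : PackagedArrowPresentation.{u}) (e : G.E) :
    (Setoid.ker fun j : Bool × Bool => xor j.1 j.2) ≤ G.bcl.comap fun j => G.arrow (e, j) := by
  rintro ⟨i, _ | _⟩ ⟨i', _ | _⟩ h
  · obtain rfl : i = i' := by simpa [Setoid.ker_def] using h
    exact Setoid.refl' _ _
  · obtain rfl : i = !i' := by simpa [Setoid.ker_def] using h
    exact Setoid.symm' _ (G.bcl_edge e i')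
  · obtain rfl : (!i) = i' := by simpa [Setoid.ker_def] using h
    exact G.bcl_edge e i
  · obtain rfl : i = i' := by simpa [Setoid.ker_def] using h
    exact Setoid.refl' _ _

/-- Brings the unchanged vertex partition of a deletion into the same form as a merged one, so that
all five operations are treated alike; `bcl_eq_sup` does this for contraction and the boundary
partition. -/
theorem vcl_eq_sup (G : PackagedArrowPresentation.{u}) (e : G.E) :
    G.vcl = G.vcl ⊔ (Setoid.ker Prod.fst).map fun j => G.arrow (e, j) :=
  (sup_eq_left.2 ((Setoid.map_le_iff_le_comap _ _ _).2 (G.ker_fst_le_comap_vcl e))).symm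

theorem bcl_eq_sup (G : PackagedArrowPresentation.{u}) (e : G.E) :
    G.bcl = G.bcl ⊔ (Setoid.ker fun j : Bool × Bool => xor j.1 j.2).map fun j => G.arrow (e, j) :=
  (sup_eq_left.2 ((Setoid.map_le_iff_le_comap _ _ _).2 (G.ker_xor_le_comap_bcl e))).symm

/-- The monomial that counts the blocks of three partitions. -/
noncomputable def blockMonomial {R X : Type*} [CommSemiring R] (α β γ : R) (A B C : Setoid X) : R :=
  α ^ Nat.card (Quotient A) * β ^ Nat.card (Quotient B) * γ ^ Nat.card (Quotient C)

/-- The contribution of a state `s`, which assigns one of the five operations to each edge. -/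
noncomputable def stateTerm {R : Type*} [CommSemiring R] (α β γ : R)
    (G : PackagedArrowPresentation.{u}) (s : G.E → Fin 5) : R :=
  blockMonomial α β γ (G.uniteAt id G.strandSetoid fun f => arcPairing (s f))
    (G.uniteAt id G.vcl fun f => vertexPairing (s f))
    (G.uniteAt id G.bcl fun f => boundaryPairing (s f))

/-- The state sum with weights that may depend on the edge. -/
noncomputable def stateSum {R : Type*} [CommSemiring R] (α β γ : R)
    (G : PackagedArrowPresentation.{u}) (w : G.E → Fin 5 → R) : R :=
  weightedSum w (stateTerm α β γ G)

/-- The contribution of a state in which the edge `e` is resolved by the operation `i`. -/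
noncomputable def partialStateTerm {R : Type*} [CommSemiring R] (α β γ : R)
    (G : PackagedArrowPresentation.{u}) (e : G.E) (i : Fin 5) (s : {f // f ≠ e} → Fin 5) : R :=
  blockMonomial α β γ
    (G.uniteAt Subtype.val (G.strandSetoid ⊔ (arcPairing i).map fun j => G.arrow (e, j))
      fun f => arcPairing (s f))
    (G.uniteAt Subtype.val (G.vcl ⊔ (vertexPairing i).map fun j => G.arrow (e, j))
      fun f => vertexPairing (s f))
    (G.uniteAt Subtype.val (G.bcl ⊔ (boundaryPairing i).map fun j => G.arrow (e, j))
      fun f => boundaryPairing (s f))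

section stateSum

variable {R : Type*} [CommSemiring R] (α β γ : R) (G : PackagedArrowPresentation.{u}) (e : G.E)

theorem stateTerm_insertState (i : Fin 5) (s : {f // f ≠ e} → Fin 5) :
    stateTerm α β γ G (insertState e i s) = partialStateTerm α β γ G e i s := by
  simp only [stateTerm, partialStateTerm, G.uniteAt_insertState, G.uniteAt_sup]

/-- An operation keeps the set of points and changes each of the three partitions by a join with a
partition of the end points of `e`. This lemma and the next four check that these are the ones
tabulated in the pairings. -/
theorem stateTerm_del (s : {f // f ≠ e} → Fin 5) :
    stateTerm α β γ (G.del e) s = partialStateTerm α β γ G e 0 s := by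
  have h := G.strandSetoid_resolve e (fun j => (j.1, !j.2)) (by decide) (by decide)
    (arcPairing 0) (by decide : ∀ j j', pairingColor 0 j = pairingColor 0 j' ↔
      j' = j ∨ j' = (j.1, !j.2))
  rw [partialStateTerm, ← h]
  -- `erw` sees through `vertexPairing 0` to `Setoid.ker Prod.fst` and through `boundaryPairing 0`
  -- to `⊤`.
  erw [← G.vcl_eq_sup e, ← G.mergedBcl_eq e]
  rfl

theorem stateTerm_con (s : {f // f ≠ e} → Fin 5) :
    stateTerm α β γ (G.con e) s = partialStateTerm α β γ G e 1 s := by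
  have h := G.strandSetoid_resolve e (fun j => (!j.1, !j.2)) (by decide) (by decide)
    (arcPairing 1) (by decide : ∀ j j', pairingColor 1 j = pairingColor 1 j' ↔
      j' = j ∨ j' = (!j.1, !j.2))
  rw [partialStateTerm, ← h]
  erw [← G.mergedVcl_eq e, ← G.bcl_eq_sup e]
  rfl

theorem stateTerm_penroseCon (s : {f // f ≠ e} → Fin 5) :
    stateTerm α β γ (G.penroseCon e) s = partialStateTerm α β γ G e 2 s := by
  have h := G.strandSetoid_resolve e (fun j => (!j.1, j.2)) (by decide) (by decide)
    (arcPairing 2) (by decide : ∀ j j', pairingColor 2 j = pairingColor 2 j' ↔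
      j' = j ∨ j' = (!j.1, j.2))
  rw [partialStateTerm, ← h]
  erw [← G.mergedVcl_eq e, ← G.mergedBcl_eq e]
  rfl

theorem stateTerm_mergeDel (s : {f // f ≠ e} → Fin 5) :
    stateTerm α β γ (G.mergeDel e) s = partialStateTerm α β γ G e 3 s := by
  have h := G.strandSetoid_resolve e (fun j => (j.1, !j.2)) (by decide) (by decide)
    (arcPairing 3) (by decide : ∀ j j', pairingColor 3 j = pairingColor 3 j' ↔
      j' = j ∨ j' = (j.1, !j.2))
  rw [partialStateTerm, ← h]
  erw [← G.mergedVcl_eq e, ← G.mergedBcl_eq e]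
  rfl

theorem stateTerm_mergeCon (s : {f // f ≠ e} → Fin 5) :
    stateTerm α β γ (G.mergeCon e) s = partialStateTerm α β γ G e 4 s := by
  have h := G.strandSetoid_resolve e (fun j => (!j.1, !j.2)) (by decide) (by decide)
    (arcPairing 4) (by decide : ∀ j j', pairingColor 4 j = pairingColor 4 j' ↔
      j' = j ∨ j' = (!j.1, !j.2))
  rw [partialStateTerm, ← h]
  erw [← G.mergedVcl_eq e, ← G.mergedBcl_eq e]
  rfl

theorem stateSum_split (w : G.E → Fin 5 → R) :
    stateSum α β γ G w = ∑ i, w e i *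
      weightedSum (fun f : {f // f ≠ e} => w f.1) (partialStateTerm α β γ G e i) := by
  simp only [stateSum, weightedSum_split e w, stateTerm_insertState]

theorem stateSum_del (w : Fin 5 → R) : stateSum α β γ (G.del e) (fun _ => w) =
    weightedSum (fun _ => w) (partialStateTerm α β γ G e 0) :=
  congrArg (weightedSum fun _ => w) (funext (stateTerm_del α β γ G e))

theorem stateSum_con (w : Fin 5 → R) : stateSum α β γ (G.con e) (fun _ => w) =
    weightedSum (fun _ => w) (partialStateTerm α β γ G e 1) :=
  congrArg (weightedSum fun _ => w) (funext (stateTerm_con α β γ G e))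

theorem stateSum_penroseCon (w : Fin 5 → R) : stateSum α β γ (G.penroseCon e) (fun _ => w) =
    weightedSum (fun _ => w) (partialStateTerm α β γ G e 2) :=
  congrArg (weightedSum fun _ => w) (funext (stateTerm_penroseCon α β γ G e))

theorem stateSum_mergeDel (w : Fin 5 → R) : stateSum α β γ (G.mergeDel e) (fun _ => w) =
    weightedSum (fun _ => w) (partialStateTerm α β γ G e 3) :=
  congrArg (weightedSum fun _ => w) (funext (stateTerm_mergeDel α β γ G e))

theorem stateSum_mergeCon (w : Fin 5 → R) : stateSum α β γ (G.mergeCon e) (fun _ => w) =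
    weightedSum (fun _ => w) (partialStateTerm α β γ G e 4) :=
  congrArg (weightedSum fun _ => w) (funext (stateTerm_mergeCon α β γ G e))

theorem stateSum_of_isEmpty [IsEmpty G.E] (w : G.E → Fin 5 → R) :
    stateSum α β γ G w =
      α ^ G.numVertices * β ^ G.numVertexClasses * γ ^ G.numBoundaryClasses := by
  rw [stateSum, weightedSum_of_isEmpty, stateTerm, blockMonomial]
  simp only [ArrowPresentation.uniteAt, iSup_of_empty, sup_bot_eq,
    ArrowPresentation.strandSetoid_eq_vertexSetoid]
  rfl

end stateSum

/-! ### The polynomial `Q` as a state sum -/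

theorem IsQ.unique {F F' : PackagedArrowPresentation.{u} → QRing} (hF : IsQ F) (hF' : IsQ F') :
    F = F' := by
  have key : ∀ (n : ℕ) (G : PackagedArrowPresentation.{u}), Nat.card G.E = n → F G = F' G := by
    intro n
    induction n using Nat.strong_induction_on with
    | _ n ih =>
      rintro G rfl
      rcases isEmpty_or_nonempty G.E with h | ⟨⟨e⟩⟩
      · rw [hF.edgeless G h, hF'.edgeless G h]
      · have hlt := G.card_edges_lt e
        rw [hF.edge G e, hF'.edge G e, ih _ hlt (G.del e) rfl, ih _ hlt (G.con e) rfl,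
          ih _ hlt (G.penroseCon e) rfl, ih _ hlt (G.mergeDel e) rfl, ih _ hlt (G.mergeCon e) rfl]
  exact funext fun G => key _ G rfl

/-- Sorting the states by their value at `e` gives the recursion, for whichever edge `e`; this is
why the arbitrary choice of edges in the definition of `Q` is harmless. -/
theorem isQ_stateSum : IsQ fun G : PackagedArrowPresentation.{u} =>
    stateSum (X 5 : QRing) (X 6) (X 7) G fun _ => ![X 0, X 1, X 2, X 3, X 4] where
  edge G e := by
    simp only [stateSum_del, stateSum_con, stateSum_penroseCon, stateSum_mergeDel,
      stateSum_mergeCon, stateSum_split _ _ _ G e, Fin.sum_univ_five]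
    rfl
  edgeless G _ := stateSum_of_isEmpty _ _ _ G _

theorem Q_eq_stateSum (G : PackagedArrowPresentation.{u}) :
    G.Q = stateSum (X 5 : QRing) (X 6) (X 7) G fun _ => ![X 0, X 1, X 2, X 3, X 4] := by
  have key : ∀ (n : ℕ) (G : PackagedArrowPresentation.{u}), Nat.card G.E = n →
      G.Q = stateSum (X 5 : QRing) (X 6) (X 7) G fun _ => ![X 0, X 1, X 2, X 3, X 4] := by
    intro n
    induction n using Nat.strong_induction_on with
    | _ n ih =>
      rintro G rfl
      by_cases h : Nonempty G.E
      · have hlt := G.card_edges_lt h.some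
        rw [Q, dif_pos h, isQ_stateSum.edge G h.some, ih _ hlt (G.del h.some) rfl,
          ih _ hlt (G.con h.some) rfl, ih _ hlt (G.penroseCon h.some) rfl,
          ih _ hlt (G.mergeDel h.some) rfl, ih _ hlt (G.mergeCon h.some) rfl]
      · rw [Q, dif_neg h]
        exact (isQ_stateSum.edgeless G (not_nonempty_iff.1 h)).symm
  exact key _ G rfl

theorem isQ_Q : IsQ Q.{u} := by
  have h : Q.{u} = _ := funext Q_eq_stateSum
  rw [h]
  exact isQ_stateSum

end PackagedArrowPresentation

/-! ### Pairings of the four end points -/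

/-- A partition into at most two blocks can only be coarsened by uniting them. -/
theorem eq_ker_or_eq_top {J : Type*} {c : J → Bool} {r : Setoid J} (h : Setoid.ker c ≤ r) :
    r = Setoid.ker c ∨ r = ⊤ := by
  refine or_iff_not_imp_left.2 fun hne => ?_
  have hnle : ¬r ≤ Setoid.ker c := fun h' => hne (le_antisymm h' h)
  obtain ⟨x, y, hxy, hc⟩ : ∃ x y, r x y ∧ c x ≠ c y := by
    by_contra! h'
    exact hnle fun x y hxy => h' x y hxy
  have key : ∀ z, r x z := by
    intro z
    by_cases hz : c x = c z
    · exact h hz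
    · refine r.trans' hxy (h ?_)
      change c y = c z
      revert hc hz
      cases c x <;> cases c y <;> cases c z <;> simp
  exact Setoid.ext fun z z' => iff_of_true (r.trans' (r.symm' (key z)) (key z')) trivial

theorem eq_top_of_ker_le {J : Type*} {c c' : J → Bool} {r : Setoid J} (h : Setoid.ker c ≤ r)
    (h' : Setoid.ker c' ≤ r) (hc : ∃ x y, c' x = c' y ∧ c x ≠ c y) : r = ⊤ := by
  rcases eq_ker_or_eq_top h with rfl | rfl
  · obtain ⟨x, y, hxy, hne⟩ := hc
    exact absurd (h' hxy) hne
  · rfl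

theorem card_quotient_ker_eq_two {J : Type*} {c : J → Bool} (hc : Function.Surjective c) :
    Nat.card (Quotient (Setoid.ker c)) = 2 := by
  rw [Nat.card_congr (Setoid.quotientKerEquivOfSurjective c hc)]
  simp

theorem card_quotient_top {J : Type*} [Nonempty J] :
    Nat.card (Quotient (⊤ : Setoid J)) = 1 := by
  have : Subsingleton (Quotient (⊤ : Setoid J)) := Quotient.subsingleton_iff.2 rfl
  have : Nonempty (Quotient (⊤ : Setoid J)) := ⟨Quotient.mk _ (Classical.arbitrary J)⟩
  exact Nat.card_unique

theorem card_quotient_arcPairing_sup (i j : Fin 5) :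
    Nat.card (Quotient (arcPairing i ⊔ arcPairing j)) =
      if pairingColor i = pairingColor j then 2 else 1 := by
  split_ifs with h
  · rw [arcPairing, arcPairing, h, sup_idem]
    exact card_quotient_ker_eq_two
      ((by decide : ∀ j, Function.Surjective (pairingColor j)) j)
  · rw [eq_top_of_ker_le (r := arcPairing i ⊔ arcPairing j) le_sup_left le_sup_right]
    · exact card_quotient_top
    · revert h
      exact (by decide : ∀ i j : Fin 5, ¬pairingColor i = pairingColor j →
        ∃ x y, pairingColor j x = pairingColor j y ∧ pairingColor i x ≠ pairingColor i y) i j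

theorem card_quotient_vertexPairing_sup (i j : Fin 5) :
    Nat.card (Quotient (vertexPairing i ⊔ vertexPairing j)) = if i = 0 ∧ j = 0 then 2 else 1 := by
  by_cases hi : i = 0 <;> by_cases hj : j = 0 <;>
    simp [vertexPairing, hi, hj, card_quotient_ker_eq_two Prod.fst_surjective]

theorem card_quotient_boundaryPairing_sup (i j : Fin 5) :
    Nat.card (Quotient (boundaryPairing i ⊔ boundaryPairing j)) =
      if i = 1 ∧ j = 1 then 2 else 1 := by
  by_cases hi : i = 1 <;> by_cases hj : j = 1 <;>
    simp [boundaryPairing, hi, hj,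
      card_quotient_ker_eq_two (c := fun j : Bool × Bool => xor j.1 j.2) (by decide)]

theorem bool_equiv_eq_refl_or_not (φ : Bool ≃ Bool) : φ = Equiv.refl Bool ∨ φ = Equiv.boolNot := by
  have h : φ true ≠ φ false := fun h => by simpa using φ.injective h
  cases h0 : φ false <;> cases h1 : φ true
  · simp_all
  · exact Or.inl (Equiv.ext fun b => by cases b <;> simp [h0, h1])
  · exact Or.inr (Equiv.ext fun b => by cases b <;> simp [h0, h1])
  · simp_all

/-- A coupling at most exchanges the two arrows, which flips the colors `fst` and `xor` everywhere
and keeps `snd`. Hence every pairing is invariant under couplings. -/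
theorem pairingColor_coupling (φ : Bool ≃ Bool) (i : Fin 5) (j j' : Bool × Bool) :
    pairingColor i (φ j.1, j.2) = pairingColor i (φ j'.1, j'.2) ↔
      pairingColor i j = pairingColor i j' := by
  rcases bool_equiv_eq_refl_or_not φ with rfl | rfl
  · rfl
  · exact (by decide : ∀ (i : Fin 5) (j j' : Bool × Bool),
      pairingColor i (!j.1, j.2) = pairingColor i (!j'.1, j'.2) ↔
        pairingColor i j = pairingColor i j') i j j'

theorem arcPairing_comap (φ : Bool ≃ Bool) (i : Fin 5) :
    (arcPairing i).comap (fun j => (φ j.1, j.2)) = arcPairing i :=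
  Setoid.ext (pairingColor_coupling φ i)

theorem vertexPairing_comap (φ : Bool ≃ Bool) (i : Fin 5) :
    (vertexPairing i).comap (fun j => (φ j.1, j.2)) = vertexPairing i := by
  by_cases h : i = 0
  · subst h
    exact arcPairing_comap φ 0
  · rw [vertexPairing, if_neg h]
    rfl

theorem boundaryPairing_comap (φ : Bool ≃ Bool) (i : Fin 5) :
    (boundaryPairing i).comap (fun j => (φ j.1, j.2)) = boundaryPairing i := by
  by_cases h : i = 1
  · subst h
    exact arcPairing_comap φ 1
  · rw [boundaryPairing, if_neg h]
    rfl

theorem Setoid.map_comp_coupling {X : Type*} (φ : Bool ≃ Bool) {r : Setoid (Bool × Bool)}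
    (hr : r.comap (fun j => (φ j.1, j.2)) = r) (k : Bool × Bool → X) :
    r.map (fun j => k (φ j.1, j.2)) = r.map k := by
  refine le_antisymm ((Setoid.map_le_iff_le_comap _ _ _).2 fun j j' h => ?_)
    ((Setoid.map_le_iff_le_comap _ _ _).2 fun j j' h => ?_)
  · exact Setoid.map_rel r k (x := (φ j.1, j.2)) (y := (φ j'.1, j'.2)) (by rwa [← hr] at h)
  · have h' : r (φ.symm j.1, j.2) (φ.symm j'.1, j'.2) := by
      rw [← hr]
      simpa [Setoid.comap_rel] using h
    have h'' := Setoid.map_rel r (fun j => k (φ j.1, j.2)) h'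
    simp only [Equiv.apply_symm_apply] at h''
    exact h''

/-- The other end point with the same color. -/
def pairingPartner : Fin 5 → Bool × Bool → Bool × Bool :=
  ![fun j => (j.1, !j.2), fun j => (!j.1, !j.2), fun j => (!j.1, j.2), fun j => (j.1, !j.2),
    fun j => (!j.1, !j.2)]

theorem arcPairing_iff (i : Fin 5) (j j' : Bool × Bool) :
    arcPairing i j j' ↔ j' = j ∨ j' = pairingPartner i j :=
  (by decide : ∀ (i : Fin 5) (j j' : Bool × Bool),
    pairingColor i j = pairingColor i j' ↔ j' = j ∨ j' = pairingPartner i j) i j j'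

theorem pairingPartner_pairingPartner (i : Fin 5) (j : Bool × Bool) :
    pairingPartner i (pairingPartner i j) = j :=
  (by decide : ∀ (i : Fin 5) (j : Bool × Bool), pairingPartner i (pairingPartner i j) = j) i j

theorem pairingPartner_ne (i : Fin 5) (j : Bool × Bool) : pairingPartner i j ≠ j :=
  (by decide : ∀ (i : Fin 5) (j : Bool × Bool), pairingPartner i j ≠ j) i j

set_option maxRecDepth 20000 in
theorem exists_eq_arcPairing {r : Setoid (Bool × Bool)} (h : ∀ j, ∃! j', j' ≠ j ∧ r j j') :
    r = arcPairing 0 ∨ r = arcPairing 1 ∨ r = arcPairing 2 := by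
  choose p hp hp' using h
  have hr : ∀ j j', r j j' ↔ j' = j ∨ j' = p j := by
    intro j j'
    refine ⟨fun h => or_iff_not_imp_left.2 fun hne => hp' j j' ⟨hne, h⟩, ?_⟩
    rintro (rfl | rfl)
    · exact r.refl' _
    · exact (hp j).2
  have hpp : ∀ j, p (p j) = j := fun j =>
    (hp' (p j) j ⟨(hp j).1.symm, r.symm' (hp j).2⟩).symm
  have hval : ∀ i, (∀ j, p j = pairingPartner i j) → r = arcPairing i := fun i hi =>
    Setoid.ext fun j j' => by rw [hr, arcPairing_iff, hi]
  have hne := fun j => (hp j).1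
  have : (∀ j, p j = pairingPartner 0 j) ∨ (∀ j, p j = pairingPartner 1 j) ∨
      ∀ j, p j = pairingPartner 2 j := by
    -- Four points have three fixed point free involutions; in curried form `decide` verifies this
    -- over all maps.
    have key : ∀ q : Bool → Bool → Bool × Bool, (∀ x y, q x y ≠ (x, y)) →
        (∀ x y, q (q x y).1 (q x y).2 = (x, y)) → (∀ x y, q x y = pairingPartner 0 (x, y)) ∨
          (∀ x y, q x y = pairingPartner 1 (x, y)) ∨ ∀ x y, q x y = pairingPartner 2 (x, y) := by
      decide
    exact (key (fun x y => p (x, y)) (fun x y => hne (x, y)) fun x y => hpp (x, y)).imp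
      (fun h j => h j.1 j.2) (Or.imp (fun h j => h j.1 j.2) fun h j => h j.1 j.2)
  exact this.imp (hval 0) (Or.imp (hval 1) (hval 2))

/-! ### The strands at a single unresolved edge -/

namespace ArrowPresentation

open Classical in
/-- The way the arcs are joined when all edges but `e` are resolved as prescribed by `s`. -/
noncomputable def resolvedJoin (G : ArrowPresentation.{u}) (e : G.E)
    (s : {f // f ≠ e} → Fin 5) : G.Pt → G.Pt :=
  Function.extend G.arrow
    (fun p => if h : p.1 = e then G.arrow p
      else G.arrow (p.1, pairingPartner (s ⟨p.1, h⟩) p.2)) G.join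

section resolvedJoin

variable (G : ArrowPresentation.{u}) (e : G.E) (s : {f // f ≠ e} → Fin 5)

theorem resolvedJoin_self (j : Bool × Bool) :
    G.resolvedJoin e s (G.arrow (e, j)) = G.arrow (e, j) := by
  rw [resolvedJoin, G.arrow_injective.extend_apply, dif_pos rfl]

theorem resolvedJoin_of_ne (f : {f // f ≠ e}) (j : Bool × Bool) :
    G.resolvedJoin e s (G.arrow (f.1, j)) = G.arrow (f.1, pairingPartner (s f) j) := by
  rw [resolvedJoin, G.arrow_injective.extend_apply, dif_neg f.2]

theorem resolvedJoin_of_not {x : G.Pt} (hx : ¬∃ p, G.arrow p = x) :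
    G.resolvedJoin e s x = G.join x :=
  Function.extend_apply' _ _ _ hx

theorem join_not_arrow {x : G.Pt} (hx : ¬∃ p, G.arrow p = x) : ¬∃ p, G.arrow p = G.join x := by
  rintro ⟨p, hp⟩
  have h := G.join_arrow p
  rw [hp, G.join_join] at h
  exact hx ⟨p, hp.trans h.symm⟩

/-- Every point is an end point of `e`, an end point of another edge, or not on an arrow. -/
theorem arrow_cases (x : G.Pt) : (∃ j, G.arrow (e, j) = x) ∨
    (∃ (f : {f // f ≠ e}) (j : Bool × Bool), G.arrow (f.1, j) = x) ∨ ¬∃ p, G.arrow p = x := by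
  by_cases hx : ∃ p, G.arrow p = x
  · obtain ⟨⟨f, j⟩, rfl⟩ := hx
    by_cases hf : f = e
    · subst hf
      exact Or.inl ⟨j, rfl⟩
    · exact Or.inr (Or.inl ⟨⟨f, hf⟩, j, rfl⟩)
  · exact Or.inr (Or.inr hx)

theorem resolvedJoin_resolvedJoin (x : G.Pt) :
    G.resolvedJoin e s (G.resolvedJoin e s x) = x := by
  rcases G.arrow_cases e x with ⟨j, rfl⟩ | ⟨f, j, rfl⟩ | hx
  · rw [resolvedJoin_self, resolvedJoin_self]
  · rw [resolvedJoin_of_ne, resolvedJoin_of_ne, pairingPartner_pairingPartner]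
  · rw [resolvedJoin_of_not _ _ _ hx, resolvedJoin_of_not _ _ _ (G.join_not_arrow hx), G.join_join]

theorem exists_of_resolvedJoin_eq_self {x : G.Pt} (h : G.resolvedJoin e s x = x) :
    ∃ j, G.arrow (e, j) = x := by
  rcases G.arrow_cases e x with hx | ⟨f, j, rfl⟩ | hx
  · exact hx
  · rw [resolvedJoin_of_ne] at h
    exact absurd (congrArg Prod.snd (G.arrow_injective h)) (pairingPartner_ne _ _)
  · rw [resolvedJoin_of_not _ _ _ hx, G.join_eq_self_iff] at h
    exact absurd h hx

theorem uniteAt_rel {F : Type*} (ι : F → G.E) (r : Setoid G.Pt) (P : F → Setoid (Bool × Bool))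
    (f : F) {j j' : Bool × Bool} (h : P f j j') :
    G.uniteAt ι r P (G.arrow (ι f, j)) (G.arrow (ι f, j')) :=
  (le_sup_right.trans' (le_iSup (fun f => (P f).map fun j => G.arrow (ι f, j)) f) :
    _ ≤ G.uniteAt ι r P) (Setoid.map_rel (P f) (fun j => G.arrow (ι f, j)) h)

theorem uniteAt_le {F : Type*} {ι : F → G.E} {r t : Setoid G.Pt}
    {P : F → Setoid (Bool × Bool)} (hr : r ≤ t)
    (h : ∀ f j j', P f j j' → t (G.arrow (ι f, j)) (G.arrow (ι f, j'))) :
    G.uniteAt ι r P ≤ t :=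
  sup_le hr (iSup_le fun f => (Setoid.map_le_iff_le_comap _ _ _).2 fun j j' => h f j j')

theorem le_uniteAt {F : Type*} (ι : F → G.E) (r : Setoid G.Pt)
    (P : F → Setoid (Bool × Bool)) : r ≤ G.uniteAt ι r P :=
  le_sup_left

theorem uniteAt_mono {F : Type*} (ι : F → G.E) {r r' : Setoid G.Pt}
    {P P' : F → Setoid (Bool × Bool)} (hr : r ≤ r') (hP : ∀ f, P f ≤ P' f) :
    G.uniteAt ι r P ≤ G.uniteAt ι r' P' :=
  G.uniteAt_le (hr.trans (G.le_uniteAt _ _ _)) fun f _ _ h => G.uniteAt_rel _ _ _ f (hP f h)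

/-- Rewrites the united strands as the orbits of two involutions, to which
`existsUnique_fixed_ne_of_involutions` applies. -/
theorem eqvGen_resolvedJoin :
    Relation.EqvGen.setoid (fun x y => y = G.arc x ∨ y = G.resolvedJoin e s x) =
      G.uniteAt Subtype.val G.strandSetoid fun f => arcPairing (s f) := by
  set t := Relation.EqvGen.setoid fun x y => y = G.arc x ∨ y = G.resolvedJoin e s x with ht
  have harc : ∀ x, t x (G.arc x) := fun x => Relation.EqvGen.rel _ _ (Or.inl rfl)
  have hjoin : ∀ x, t x (G.resolvedJoin e s x) := fun x => Relation.EqvGen.rel _ _ (Or.inr rfl)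
  refine le_antisymm (Setoid.eqvGen_le ?_) (G.uniteAt_le (G.strandSetoid_le harc fun x => ?_)
    fun f j j' h => ?_)
  · rintro x _ (rfl | rfl)
    · exact G.le_uniteAt _ _ _ (G.strandSetoid_arc x)
    · rcases G.arrow_cases e x with ⟨j, rfl⟩ | ⟨f, j, rfl⟩ | hx
      · rw [resolvedJoin_self]
      · rw [resolvedJoin_of_ne]
        exact G.uniteAt_rel _ _ _ f ((arcPairing_iff _ _ _).2 (Or.inr rfl))
      · rw [resolvedJoin_of_not _ _ _ hx]
        exact G.le_uniteAt _ _ _ (G.strandSetoid_join x)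
  · by_cases hx : ∃ p, G.arrow p = x
    · obtain ⟨p, rfl⟩ := hx
      rw [G.join_arrow]
    · rw [← G.resolvedJoin_of_not e s hx]
      exact hjoin x
  · rcases (arcPairing_iff _ _ _).1 h with rfl | rfl
    · exact t.refl' _
    · rw [← G.resolvedJoin_of_ne e s f j]
      exact hjoin _

/-- The fixed points of `resolvedJoin` are exactly the end points of `e`, so a strand that starts at
one of them is a path ending at exactly one other. -/
theorem existsUnique_strand_end (j : Bool × Bool) :
    ∃! j', j' ≠ j ∧ G.uniteAt Subtype.val G.strandSetoid (fun f => arcPairing (s f))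
      (G.arrow (e, j)) (G.arrow (e, j')) := by
  obtain ⟨y, ⟨hne, hy, hrel⟩, huniq⟩ := existsUnique_fixed_ne_of_involutions G.arc_arc G.arc_ne
    (G.resolvedJoin_resolvedJoin e s) (G.resolvedJoin_self e s j)
  rw [eqvGen_resolvedJoin] at hrel huniq
  obtain ⟨j', rfl⟩ := G.exists_of_resolvedJoin_eq_self e s hy
  refine ⟨j', ⟨fun h => hne (by rw [h]), hrel⟩, fun j'' h => ?_⟩
  exact G.arrow_at_injective e (huniq _ ⟨fun h' => h.1 (G.arrow_at_injective e h'),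
    G.resolvedJoin_self e s j'', h.2⟩)

end resolvedJoin

end ArrowPresentation

namespace PackagedArrowPresentation

theorem strandSetoid_le_vcl (G : PackagedArrowPresentation.{u}) : G.strandSetoid ≤ G.vcl :=
  G.strandSetoid_le G.vcl_arc G.vcl_join

theorem strandSetoid_le_bcl (G : PackagedArrowPresentation.{u}) : G.strandSetoid ≤ G.bcl :=
  G.strandSetoid_le G.bcl_arc G.bcl_join

/-- When all edges but `e` are resolved, the end points of `e` are connected in one of five ways. -/
theorem exists_pairing (G : PackagedArrowPresentation.{u}) (e : G.E)
    (s : {f // f ≠ e} → Fin 5) :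
    ∃ i,
      (G.uniteAt Subtype.val G.strandSetoid fun f => arcPairing (s f)).comap
        (fun j => G.arrow (e, j)) = arcPairing i ∧
      (G.uniteAt Subtype.val G.vcl fun f => vertexPairing (s f)).comap
        (fun j => G.arrow (e, j)) = vertexPairing i ∧
      (G.uniteAt Subtype.val G.bcl fun f => boundaryPairing (s f)).comap
        (fun j => G.arrow (e, j)) = boundaryPairing i := by
  set A := G.uniteAt Subtype.val G.strandSetoid fun f => arcPairing (s f)
  set B := G.uniteAt Subtype.val G.vcl fun f => vertexPairing (s f)
  set C := G.uniteAt Subtype.val G.bcl fun f => boundaryPairing (s f)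
  set k : Bool × Bool → G.Pt := fun j => G.arrow (e, j)
  -- Strands stay inside vertex classes and boundary classes, also after the other edges are
  -- resolved.
  have hAB : A.comap k ≤ B.comap k := fun _ _ h =>
    G.uniteAt_mono _ G.strandSetoid_le_vcl (fun _ => arcPairing_le_vertexPairing _) h
  have hAC : A.comap k ≤ C.comap k := fun _ _ h =>
    G.uniteAt_mono _ G.strandSetoid_le_bcl (fun _ => arcPairing_le_boundaryPairing _) h
  have hB : Setoid.ker (pairingColor 0) ≤ B.comap k := fun _ _ h =>
    G.le_uniteAt _ _ _ (G.ker_fst_le_comap_vcl e h)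
  have hC : Setoid.ker (pairingColor 1) ≤ C.comap k := fun _ _ h =>
    G.le_uniteAt _ _ _ (G.ker_xor_le_comap_bcl e h)
  -- If the strands match the ends of each arrow, the boundary trace is forced to be trivial and the
  -- vertex trace has two options; if they match heads with opposite tails, the roles are exchanged;
  -- in the Penrose case both are trivial.
  rcases exists_eq_arcPairing (r := A.comap k) (G.existsUnique_strand_end e s) with h | h | h <;>
    rw [h] at hAB hAC ⊢
  · have hC' : C.comap k = ⊤ := eq_top_of_ker_le hC hAC (by decide)
    rcases eq_ker_or_eq_top hB with hB' | hB'
    · exact ⟨0, rfl, hB', hC'⟩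
    · exact ⟨3, rfl, hB', hC'⟩
  · have hB' : B.comap k = ⊤ := eq_top_of_ker_le hB hAB (by decide)
    rcases eq_ker_or_eq_top hC with hC' | hC'
    · exact ⟨1, rfl, hB', hC'⟩
    · exact ⟨4, rfl, hB', hC'⟩
  · exact ⟨2, rfl, eq_top_of_ker_le hB hAB (by decide), eq_top_of_ker_le hC hAC (by decide)⟩

end PackagedArrowPresentation

/-! ### State sums of 2-sums -/

namespace ArrowPresentation

section twoSum

variable (G : ArrowPresentation.{u}) (f : G.E) (H : ArrowPresentation.{u}) (e : H.E)
  (φ : Bool ≃ Bool)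

/-- The end points of `f` and `e` are free ends of strands, so the 2-sum glues strands there without
cutting any. -/
theorem strandSetoid_twoSum :
    (G.twoSum f H e φ).strandSetoid =
      gluePartition G.strandSetoid H.strandSetoid (fun j : Bool × Bool => G.arrow (f, j))
        (fun j => H.arrow (e, φ j.1, j.2)) := by
  refine le_antisymm (strandSetoid_le _ ?_ ?_) (gluePartition_le ?_ ?_ fun j => ?_)
  · rintro (x | x)
    · exact gluePartition_inl (G.strandSetoid_arc x)
    · exact gluePartition_inr (H.strandSetoid_arc x)
  · rintro (x | x)
    · by_cases hx : ∃ j, G.arrow (f, j) = x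
      · obtain ⟨j, rfl⟩ := hx
        rw [G.twoSum_join_inl_arrow f H e φ j]
        exact gluePartition_inl_inr j
      · rw [G.twoSum_join_inl_of_not f H e φ x hx]
        exact gluePartition_inl (G.strandSetoid_join x)
    · by_cases hx : ∃ j : Bool × Bool, H.arrow (e, φ j.1, j.2) = x
      · obtain ⟨j, rfl⟩ := hx
        rw [G.twoSum_join_inr_arrow f H e φ j]
        exact Setoid.symm' _ (gluePartition_inl_inr j)
      · rw [G.twoSum_join_inr_of_not f H e φ x hx]
        exact gluePartition_inr (H.strandSetoid_join x)
  · have h : G.strandSetoid ≤ (G.twoSum f H e φ).strandSetoid.comap Sum.inl := by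
      refine G.strandSetoid_le (fun x => ?_) fun x => ?_
      · exact (G.twoSum f H e φ).strandSetoid_arc (Sum.inl x)
      · by_cases hx : ∃ j, G.arrow (f, j) = x
        · obtain ⟨j, rfl⟩ := hx
          rw [G.join_arrow]
        · change (G.twoSum f H e φ).strandSetoid _ (Sum.inl (G.join x))
          rw [← G.twoSum_join_inl_of_not f H e φ x hx]
          exact (G.twoSum f H e φ).strandSetoid_join (Sum.inl x)
    exact fun _ _ h' => h h'
  · have h : H.strandSetoid ≤ (G.twoSum f H e φ).strandSetoid.comap Sum.inr := by
      refine H.strandSetoid_le (fun x => ?_) fun x => ?_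
      · exact (G.twoSum f H e φ).strandSetoid_arc (Sum.inr x)
      · by_cases hx : ∃ j : Bool × Bool, H.arrow (e, φ j.1, j.2) = x
        · obtain ⟨j, rfl⟩ := hx
          rw [H.join_arrow]
        · change (G.twoSum f H e φ).strandSetoid _ (Sum.inr (H.join x))
          rw [← G.twoSum_join_inr_of_not f H e φ x hx]
          exact (G.twoSum f H e φ).strandSetoid_join (Sum.inr x)
    exact fun _ _ h' => h h'
  · rw [← G.twoSum_join_inl_arrow f H e φ j]
    exact (G.twoSum f H e φ).strandSetoid_join _

/-- Each remaining edge has its four end points on one side, so uniting commutes with gluing. The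
family `P` is kept general to serve strands, vertex classes and boundary classes alike. -/
theorem uniteAt_twoSum {S J : Type*} (r : Setoid G.Pt) (r' : Setoid H.Pt) (i : J → G.Pt)
    (k : J → H.Pt) (P : S → Setoid (Bool × Bool)) (s : {f' // f' ≠ f} → S)
    (s' : {e' // e' ≠ e} → S) :
    (G.twoSum f H e φ).uniteAt id (gluePartition r r' i k) (fun g => P (Sum.elim s s' g)) =
      gluePartition (G.uniteAt Subtype.val r fun f' => P (s f'))
        (H.uniteAt Subtype.val r' fun e' => P (s' e')) i k := by
  refine le_antisymm (uniteAt_le _ (gluePartition_le (fun x y h => ?_) (fun x y h => ?_)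
    gluePartition_inl_inr) ?_) (gluePartition_le ?_ ?_ fun j => ?_)
  · exact gluePartition_inl (G.le_uniteAt _ _ _ h)
  · exact gluePartition_inr (H.le_uniteAt _ _ _ h)
  · rintro (f' | e') j j' h
    · exact gluePartition_inl (G.uniteAt_rel Subtype.val r (fun f' => P (s f')) f' h)
    · exact gluePartition_inr (H.uniteAt_rel Subtype.val r' (fun e' => P (s' e')) e' h)
  · have h : (G.uniteAt Subtype.val r fun f' => P (s f')) ≤ ((G.twoSum f H e φ).uniteAt id
        (gluePartition r r' i k) (fun g => P (Sum.elim s s' g))).comap Sum.inl := by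
      refine G.uniteAt_le (fun x y h => ?_) fun f' j j' h => ?_
      · exact le_uniteAt _ _ _ _ (gluePartition_inl h)
      · exact (G.twoSum f H e φ).uniteAt_rel id (gluePartition r r' i k)
          (fun g => P (Sum.elim s s' g)) (Sum.inl f') h
    exact fun _ _ h' => h h'
  · have h : (H.uniteAt Subtype.val r' fun e' => P (s' e')) ≤ ((G.twoSum f H e φ).uniteAt id
        (gluePartition r r' i k) (fun g => P (Sum.elim s s' g))).comap Sum.inr := by
      refine H.uniteAt_le (fun x y h => ?_) fun e' j j' h => ?_
      · exact le_uniteAt _ _ _ _ (gluePartition_inr h)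
      · exact (G.twoSum f H e φ).uniteAt_rel id (gluePartition r r' i k)
          (fun g => P (Sum.elim s s' g)) (Sum.inr e') h
    exact fun _ _ h' => h h'
  · exact le_uniteAt _ _ _ _ (gluePartition_inl_inr j)

end twoSum

end ArrowPresentation

namespace PackagedArrowPresentation

section twoSum

variable (G : PackagedArrowPresentation.{u}) (f : G.E) (H : PackagedArrowPresentation.{u})
  (e : H.E) (φ : Bool ≃ Bool)

theorem twoSumVcl_eq :
    G.twoSumVcl f H e φ = gluePartition G.vcl H.vcl (fun j : Bool × Bool => G.arrow (f, j))
      (fun j => H.arrow (e, φ j.1, j.2)) := by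
  refine le_antisymm (sup_le (sup_le le_sup_left (Setoid.eqvGen_le ?_)) (Setoid.eqvGen_le ?_))
    (gluePartition_le (fun _ _ => G.twoSumVcl_inl f H e φ) (fun _ _ => G.twoSumVcl_inr f H e φ)
      (G.twoSumVcl_coupled f H e φ))
  · rintro _ _ ⟨rfl, rfl⟩
    exact gluePartition_inl_inr (false, false)
  · rintro _ _ ⟨rfl, rfl⟩
    exact gluePartition_inl_inr (true, false)

theorem twoSumBcl_eq :
    G.twoSumBcl f H e φ = gluePartition G.bcl H.bcl (fun j : Bool × Bool => G.arrow (f, j))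
      (fun j => H.arrow (e, φ j.1, j.2)) := by
  refine le_antisymm (sup_le (sup_le le_sup_left (Setoid.eqvGen_le ?_)) (Setoid.eqvGen_le ?_))
    (gluePartition_le (fun _ _ => G.twoSumBcl_inl f H e φ) (fun _ _ => G.twoSumBcl_inr f H e φ)
      (G.twoSumBcl_coupled f H e φ))
  · rintro _ _ ⟨rfl, rfl⟩
    exact gluePartition_inl_inr (false, false)
  · rintro _ _ ⟨rfl, rfl⟩
    exact gluePartition_inl_inr (false, true)

variable {R : Type*} [CommSemiring R] (α β γ : R)

theorem blockMonomial_gluePartition {J : Type*} {X Y : Type u} [Finite X] [Finite Y]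
    (A : Setoid X) (A' : Setoid Y) (B : Setoid X) (B' : Setoid Y) (C : Setoid X) (C' : Setoid Y)
    (i : J → X) (k : J → Y) :
    blockMonomial α β γ (gluePartition A A' i k) (gluePartition B B' i k)
      (gluePartition C C' i k) =
      blockMonomial α β γ (A ⊔ (A'.comap k).map i) (B ⊔ (B'.comap k).map i)
        (C ⊔ (C'.comap k).map i) *
        (α ^ Nat.card (FreeBlock A' k) * β ^ Nat.card (FreeBlock B' k) *
          γ ^ Nat.card (FreeBlock C' k)) := by
  simp only [blockMonomial, card_quotient_gluePartition]
  ring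

/-- The monomial of a single edge with connections `j` outside, resolved by the operation `i`. -/
noncomputable def pairingMonomial (i j : Fin 5) : R :=
  blockMonomial α β γ (arcPairing i ⊔ arcPairing j) (vertexPairing i ⊔ vertexPairing j)
    (boundaryPairing i ⊔ boundaryPairing j)

/-- A state of all edges of `H` but `e` acts as one of the five operations, up to a factor. -/
theorem exists_stateTerm_twoSum_eq (s : {e' // e' ≠ e} → Fin 5) :
    ∃ (j : Fin 5) (c : R),
      (∀ i, partialStateTerm α β γ H e i s = pairingMonomial α β γ i j * c) ∧
      ∀ (G : PackagedArrowPresentation.{u}) (f : G.E) (t : {f' // f' ≠ f} → Fin 5),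
        stateTerm α β γ (G.twoSum f H e φ) (Sum.elim t s) =
          partialStateTerm α β γ G f j t * c := by
  obtain ⟨j, hA, hB, hC⟩ := H.exists_pairing e s
  set A := H.uniteAt Subtype.val H.strandSetoid fun f => arcPairing (s f)
  set B := H.uniteAt Subtype.val H.vcl fun f => vertexPairing (s f)
  set C := H.uniteAt Subtype.val H.bcl fun f => boundaryPairing (s f)
  set k : Bool × Bool → H.Pt := fun j => H.arrow (e, φ j.1, j.2)
  -- `k` lists the end points of `e` through the coupling, as the gluing does; pairings are
  -- invariant under this.
  have hA' : A.comap k = arcPairing j := by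
    rw [← arcPairing_comap φ j, ← hA]
    rfl
  have hB' : B.comap k = vertexPairing j := by
    rw [← vertexPairing_comap φ j, ← hB]
    rfl
  have hC' : C.comap k = boundaryPairing j := by
    rw [← boundaryPairing_comap φ j, ← hC]
    rfl
  -- The common factor counts the blocks of `H` that avoid the end points of `e`.
  refine ⟨j, α ^ Nat.card (FreeBlock A k) * β ^ Nat.card (FreeBlock B k) *
    γ ^ Nat.card (FreeBlock C k), fun i => ?_, fun G f t => ?_⟩
  · rw [partialStateTerm, H.uniteAt_sup, H.uniteAt_sup, H.uniteAt_sup,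
      ← Setoid.map_comp_coupling φ (arcPairing_comap φ i),
      ← Setoid.map_comp_coupling φ (vertexPairing_comap φ i),
      ← Setoid.map_comp_coupling φ (boundaryPairing_comap φ i), blockMonomial,
      card_quotient_sup_map, card_quotient_sup_map, card_quotient_sup_map, hA', hB', hC',
      pairingMonomial, blockMonomial]
    ring
  · have key := fun (r : Setoid G.Pt) (r' : Setoid H.Pt) (P : Fin 5 → Setoid (Bool × Bool)) =>
      G.uniteAt_twoSum f H.toArrowPresentation e φ r r' (fun j => G.arrow (f, j)) k P t s
    have h1 := key G.strandSetoid H.strandSetoid arcPairing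
    have h2 := key G.vcl H.vcl vertexPairing
    have h3 := key G.bcl H.bcl boundaryPairing
    rw [← G.strandSetoid_twoSum f H.toArrowPresentation e φ] at h1
    rw [← G.twoSumVcl_eq f H e φ] at h2
    rw [← G.twoSumBcl_eq f H e φ] at h3
    refine (congr (congr (congrArg (blockMonomial α β γ) h1) h2) h3).trans ?_
    refine (blockMonomial_gluePartition α β γ _ A _ B _ C (fun j => G.arrow (f, j)) k).trans ?_
    rw [hA', hB', hC', partialStateTerm, G.uniteAt_sup, G.uniteAt_sup, G.uniteAt_sup]

/-- The state sum of a 2-sum is obtained by replacing the weights of the edge `f` by a solution of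
a linear system that depends only on `H` and `e`. -/
theorem exists_stateSum_twoSum_eq (w : Fin 5 → R) :
    ∃ ψ : Fin 5 → R,
      (∀ i, weightedSum (fun _ => w) (partialStateTerm α β γ H e i) =
        ∑ j, pairingMonomial α β γ i j * ψ j) ∧
      ∀ (G : PackagedArrowPresentation.{u}) (f : G.E) (v : {f' // f' ≠ f} → Fin 5 → R),
        stateSum α β γ (G.twoSum f H e φ) (Sum.elim v fun _ => w) =
          ∑ j, ψ j * weightedSum v (partialStateTerm α β γ G f j) := by
  choose τ c hτ hG using H.exists_stateTerm_twoSum_eq e φ α β γ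
  -- The total weight, with the factors `c s`, of the states of `H` away from `e` that act as
  -- operation `j`.
  refine ⟨fun j => weightedSum (fun _ => w) fun s => if τ s = j then c s else 0,
    fun i => ?_, fun G f v => ?_⟩
  · simp only [mul_comm _ (weightedSum _ _), ← weightedSum_mul_right, ← weightedSum_finset_sum]
    refine congrArg (weightedSum fun _ => w) (funext fun s => ?_)
    simp [hτ, mul_comm]
  · simp only [mul_comm (weightedSum (fun _ => w) _), ← weightedSum_mul_right,
      ← weightedSum_finset_sum]
    refine (weightedSum_sum v (fun _ => w) _).trans ?_
    refine congrArg (weightedSum v) (funext fun t => ?_)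
    simp only [mul_comm _ (weightedSum _ _), ← weightedSum_mul_right, ← weightedSum_finset_sum]
    refine congrArg (weightedSum fun _ => w) (funext fun s => ?_)
    rw [hG]
    simp [mul_comm]

end twoSum

/-! ### The tensor product formula -/

section tensor

variable {R : Type*} [CommSemiring R] {α β γ : R} {H : PackagedArrowPresentation.{u}} {e : H.E}
  {w ψ : Fin 5 → R}

theorem inl_mem_remainingEdges {G : PackagedArrowPresentation.{u}} {f : G.E} {φ : Bool ≃ Bool}
    {l : List G.E} (f' : {f' // f' ≠ f}) :
    (Sum.inl f' : {f' // f' ≠ f} ⊕ {e' // e' ≠ e}) ∈ G.remainingEdges f H e φ l ↔ f'.1 ∈ l := by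
  simp only [remainingEdges]
  erw [List.mem_filterMap]
  constructor
  · rintro ⟨g, hg, h⟩
    split_ifs at h
    cases h
    exact hg
  · exact fun h => ⟨f'.1, h, by rw [dif_pos f'.2]; rfl⟩

theorem inr_notMem_remainingEdges {G : PackagedArrowPresentation.{u}} {f : G.E} {φ : Bool ≃ Bool}
    {l : List G.E} (e' : {e' // e' ≠ e}) :
    (Sum.inr e' : {f' // f' ≠ f} ⊕ {e' // e' ≠ e}) ∉ G.remainingEdges f H e φ l := by
  simp only [remainingEdges]
  erw [List.mem_filterMap]
  rintro ⟨g, hg, h⟩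
  split_ifs at h
  cases h

-- Each 2-sum along a listed edge trades the weights `ψ` at that edge for a copy of `H` with weights
-- `w`. New edges never enter the list, so at an intermediate stage exactly the edges still to be
-- treated carry `ψ`.
open Classical in
theorem stateSum_tensor
    (hψ : ∀ (φ : Bool ≃ Bool) (G : PackagedArrowPresentation.{u}) (f : G.E)
      (v : {f' // f' ≠ f} → Fin 5 → R),
      stateSum α β γ (G.twoSum f H e φ) (Sum.elim v fun _ => w) =
        ∑ j, ψ j * weightedSum v (partialStateTerm α β γ G f j))
    (G : PackagedArrowPresentation.{u}) (φ : G.E → Bool ≃ Bool) (l : List G.E) :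
    stateSum α β γ (tensor H e G φ l) (fun _ => w) =
      stateSum α β γ G fun f => if f ∈ l then ψ else w := by
  induction h : l.length using Nat.strong_induction_on generalizing G with
  | _ n ih =>
    subst h
    cases l with
    | nil =>
      rw [tensor]
      simp
    | cons f l =>
      have hlt : (G.remainingEdges f H e (φ f) l).length < (f :: l).length :=
        Nat.lt_succ_of_le (List.length_filterMap_le _ _)
      rw [tensor]
      refine (ih _ hlt _ _ _ rfl).trans ?_
      have hw : (fun g : (G.twoSum f H e (φ f)).E =>
          if g ∈ G.remainingEdges f H e (φ f) l then ψ else w) =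
          Sum.elim (fun f' : {f' // f' ≠ f} => if f'.1 ∈ l then ψ else w) fun _ => w := by
        funext g
        rcases g with f' | e'
        · by_cases h : f'.1 ∈ l
          · exact (if_pos ((inl_mem_remainingEdges f').2 h)).trans (if_pos h).symm
          · exact (if_neg (mt (inl_mem_remainingEdges f').1 h)).trans (if_neg h).symm
        · exact if_neg (inr_notMem_remainingEdges e')
      rw [hw, hψ, stateSum_split _ _ _ _ f]
      simp only [List.mem_cons, true_or, if_true]
      refine Finset.sum_congr rfl fun j _ => ?_
      congr 2
      funext f'
      simp [f'.2]

theorem map_stateSum {R' F : Type*} [CommSemiring R'] [FunLike F R R'] [RingHomClass F R R']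
    (g : F) (G : PackagedArrowPresentation.{u}) (v : G.E → Fin 5 → R) :
    g (stateSum α β γ G v) = stateSum (g α) (g β) (g γ) G fun e i => g (v e i) := by
  rw [stateSum, map_weightedSum]
  simp only [stateTerm, blockMonomial, map_mul, map_pow]
  rfl

end tensor

/-! ### The linear system over the field of rational functions -/

/-- The weights `a`, `b`, `c`, `x`, `y`, as rational functions. -/
noncomputable def edgeWeight (i : Fin 5) : QField := var (i.castLE (by decide))

theorem algebraMap_Q (G : PackagedArrowPresentation.{u}) :
    algebraMap QRing QField G.Q = stateSum (var 5) (var 6) (var 7) G fun _ => edgeWeight := by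
  rw [Q_eq_stateSum, map_stateSum]
  congr 1
  funext _ i
  fin_cases i <;> rfl

theorem aeval_Q (G : PackagedArrowPresentation.{u}) (ψ : Fin 5 → QField) :
    aeval ![ψ 0, ψ 1, ψ 2, ψ 3, ψ 4, var 5, var 6, var 7] G.Q =
      stateSum (var 5) (var 6) (var 7) G fun _ => ψ := by
  rw [Q_eq_stateSum, map_stateSum]
  simp only [aeval_X]
  congr 1
  funext _ i
  fin_cases i <;> simp

/-- Every exponent is 1 or 2. Beyond the factor `αβγ` there is an α when the two arc pairings agree,
a β only at deletion against deletion, and a γ only at contraction against contraction. -/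
theorem smul_tensorMatrix_apply (i j : Fin 5) :
    ((var 5 * var 6 * var 7) • tensorMatrix) i j =
      pairingMonomial (var 5) (var 6) (var 7) i j := by
  rw [pairingMonomial, blockMonomial, card_quotient_arcPairing_sup,
    card_quotient_vertexPairing_sup, card_quotient_boundaryPairing_sup]
  have h01 : ¬pairingColor 0 = pairingColor 1 := by decide
  have h02 : ¬pairingColor 0 = pairingColor 2 := by decide
  have h12 : ¬pairingColor 1 = pairingColor 2 := by decide
  have h03 : pairingColor 3 = pairingColor 0 := by decide
  have h14 : pairingColor 4 = pairingColor 1 := by decide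
  fin_cases i <;> fin_cases j <;>
    simp [tensorMatrix, h01, h02, h12, h03, h14, Ne.symm h01, Ne.symm h02, Ne.symm h12] <;> ring

theorem isTensorSolution_iff (H : PackagedArrowPresentation.{u}) (e : H.E) (ψ : Fin 5 → QField) :
    IsTensorSolution H e ψ ↔ ∀ i, weightedSum (fun _ => edgeWeight)
      (partialStateTerm (var 5) (var 6) (var 7) H e i) =
        ∑ j, pairingMonomial (var 5) (var 6) (var 7) i j * ψ j := by
  rw [IsTensorSolution, funext_iff]
  simp only [algebraMap_Q, stateSum_del, stateSum_con, stateSum_penroseCon, stateSum_mergeDel,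
    stateSum_mergeCon, Matrix.mulVec, dotProduct, smul_tensorMatrix_apply]
  refine forall_congr' fun i => ?_
  rw [eq_comm]
  fin_cases i <;> rfl

theorem var_ne_intCast (i : Fin 8) (n : ℤ) : var i ≠ n := by
  intro h
  have h' : (X i : QRing) = C n := by
    refine IsFractionRing.injective QRing QField ?_
    rw [← var, h]
    simp
  -- At the point with all coordinates `n + 1` the two sides would be `n + 1` and `n`.
  have h1 := congrArg (MvPolynomial.eval fun _ => n + 1) h'
  simp at h1

theorem tensorMatrix_mulVec_injective :
    Function.Injective ((var 5 * var 6 * var 7) • tensorMatrix).mulVec := by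
  have hne : ∀ i, var i ≠ 0 := fun i => by simpa using var_ne_intCast i 0
  have hne1 : ∀ i, var i - 1 ≠ 0 := fun i => sub_ne_zero.2 (by simpa using var_ne_intCast i 1)
  have hne2 : var 5 + 2 ≠ 0 := fun h => var_ne_intCast 5 (-2) (by
    rw [eq_neg_of_add_eq_zero_left h]
    simp)
  have h567 : var 5 * var 6 * var 7 ≠ 0 := mul_ne_zero (mul_ne_zero (hne 5) (hne 6)) (hne 7)
  refine (injective_iff_map_eq_zero
    (Matrix.mulVecLin ((var 5 * var 6 * var 7) • tensorMatrix))).2 fun v hv => ?_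
  rw [Matrix.mulVecLin_apply, Matrix.smul_mulVec, smul_eq_zero_iff_right h567] at hv
  have h0 := congrFun hv 0
  have h1 := congrFun hv 1
  have h2 := congrFun hv 2
  have h3 := congrFun hv 3
  have h4 := congrFun hv 4
  simp [tensorMatrix, Matrix.mulVec, dotProduct, Fin.sum_univ_five] at h0 h1 h2 h3 h4
  -- Rows 0 and 3 differ only in their first entry, rows 1 and 4 only in their second. What remains
  -- is the 3 by 3 matrix with α on the diagonal and 1 elsewhere, with eigenvalues `α - 1` and `α +
  -- 2`.
  have e0 : v 0 = 0 := by
    have : var 5 * (var 6 - 1) * v 0 = 0 := by linear_combination h0 - h3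
    exact (mul_eq_zero.1 this).resolve_left (mul_ne_zero (hne 5) (hne1 6))
  have e1 : v 1 = 0 := by
    have : var 5 * (var 7 - 1) * v 1 = 0 := by linear_combination h1 - h4
    exact (mul_eq_zero.1 this).resolve_left (mul_ne_zero (hne 5) (hne1 7))
  rw [e0, e1] at h2 h3 h4
  have d : ∀ a : QField, (var 5 - 1) * (var 5 + 2) * a = 0 → a = 0 := fun a h =>
    (mul_eq_zero.1 h).resolve_left (mul_ne_zero (hne1 5) hne2)
  have e2 : v 2 = 0 := d _ (by linear_combination (var 5 + 1) * h2 - h3 - h4)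
  have e3 : v 3 = 0 := d _ (by linear_combination (var 5 + 1) * h3 - h2 - h4)
  have e4 : v 4 = 0 := d _ (by linear_combination (var 5 + 1) * h4 - h3 - h2)
  funext i
  fin_cases i <;> assumption

theorem IsTensorSolution.unique {H : PackagedArrowPresentation.{u}} {e : H.E}
    {ψ ψ' : Fin 5 → QField} (h : IsTensorSolution H e ψ) (h' : IsTensorSolution H e ψ') :
    ψ = ψ' :=
  tensorMatrix_mulVec_injective (h.trans h'.symm)

/-- The weights found for a coupling could depend on it, but they solve a system in which no
coupling occurs. By uniqueness the same `ψ` serves all couplings, which may thus vary from edge to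
edge. -/
theorem IsTensorSolution.stateSum_twoSum {H : PackagedArrowPresentation.{u}} {e : H.E}
    {ψ : Fin 5 → QField} (h : IsTensorSolution H e ψ) (φ : Bool ≃ Bool)
    (G : PackagedArrowPresentation.{u}) (f : G.E) (v : {f' // f' ≠ f} → Fin 5 → QField) :
    stateSum (var 5) (var 6) (var 7) (G.twoSum f H e φ) (Sum.elim v fun _ => edgeWeight) =
      ∑ j, ψ j * weightedSum v (partialStateTerm (var 5) (var 6) (var 7) G f j) := by
  obtain ⟨ψ', h', hG⟩ := exists_stateSum_twoSum_eq H e φ (var 5) (var 6) (var 7) edgeWeight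
  rw [h.unique ((isTensorSolution_iff H e ψ').2 h')]
  exact hG G f v

end PackagedArrowPresentation

/-- `Q` is well defined and is the only map with its defining properties; the linear system has
a unique solution; and the tensor product formula holds for that solution.  Here `φ f` is the
coupling of the edge `f` of `G` with `e`, and `l` is any enumeration of the edges of `G`. -/
theorem mainTheorem3 :
    (PackagedArrowPresentation.IsQ PackagedArrowPresentation.Q.{u} ∧
      ∀ F : PackagedArrowPresentation.{u} → PackagedArrowPresentation.QRing,
        PackagedArrowPresentation.IsQ F → F = PackagedArrowPresentation.Q) ∧
    ∀ (G H : PackagedArrowPresentation.{u}) (e : H.E) (φ : G.E → Bool ≃ Bool)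
      (l : List G.E), l.Nodup → (∀ f : G.E, f ∈ l) →
      (∃! ψ : Fin 5 → PackagedArrowPresentation.QField,
        PackagedArrowPresentation.IsTensorSolution H e ψ) ∧
      ∀ ψ : Fin 5 → PackagedArrowPresentation.QField,
        PackagedArrowPresentation.IsTensorSolution H e ψ →
        algebraMap PackagedArrowPresentation.QRing PackagedArrowPresentation.QField
            (PackagedArrowPresentation.tensor H e G φ l).Q =
          aeval ![ψ 0, ψ 1, ψ 2, ψ 3, ψ 4, PackagedArrowPresentation.var 5,
            PackagedArrowPresentation.var 6, PackagedArrowPresentation.var 7] G.Q := by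
  refine ⟨⟨PackagedArrowPresentation.isQ_Q, fun F hF =>
    hF.unique PackagedArrowPresentation.isQ_Q⟩, fun G H e φ l _ hl => ⟨?_, fun ψ hψ => ?_⟩⟩
  -- Any coupling would do here, as only the linear system is used.
  · obtain ⟨ψ, hψ, -⟩ := PackagedArrowPresentation.exists_stateSum_twoSum_eq H e (Equiv.refl Bool)
      (PackagedArrowPresentation.var 5) (PackagedArrowPresentation.var 6)
      (PackagedArrowPresentation.var 7) PackagedArrowPresentation.edgeWeight
    have hψ' := (PackagedArrowPresentation.isTensorSolution_iff H e ψ).2 hψ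
    exact ⟨ψ, hψ', fun _ h => h.unique hψ'⟩
  · rw [PackagedArrowPresentation.algebraMap_Q, PackagedArrowPresentation.aeval_Q,
      PackagedArrowPresentation.stateSum_tensor hψ.stateSum_twoSum]
    simp only [hl, if_true]
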